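/- **Proposition (Nonmaximal Bessel inequality).** Conventions. Dyadic intervals are the intervals $[2^{i}l,2^{i}(l+1))$ with $i,l\in\mathbf Z$. A tile is $P=I_P\times\omega_P$ with $I_P,\omega_P$ dyadic intervals and $|I_P|\,|\omega_P|=1$. For an interval $I$ with center $c(I)$ let $\chi_I(x)=(1+(x-c(I))^2/|I|^2)^{-1/2}$. Write $\hat\psi(\xi)=\int_{\mathbf R}e^{-2\pi ix\xi}\psi(x)\,dx$, and let $0.8\,\omega$ be the closed interval with the same center as $\omega$ and $0.8$ times its length. Fix an integer $N\ge1$ and real numbers $C_0>0$, $\kappa\ge1$ and $B$. A (measurable) function $\psi_P:\mathbf R\to\mathbf C$ is a *wave packet adapted to* $P$ if $\hat\psi_P$ vanishes outside $0.8\,\omega_P$ and $|\psi_P(x)|\le B|I_P|^{-1/2}\chi_{I_P}(x)^{10N}$ for all $x\in\mathbf R$. A *lacunary tree* $\mathbf T=(\mathbf T,I_{\mathbf T},\xi_{\mathbf T})$ is a collection $\mathbf T$ of tiles with a dyadic interval $I_{\mathbf T}$ and a frequency $\xi_{\mathbf T}\in\mathbf R$ such that for all $P\in\mathbf T$ one has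 $I_P\subseteq I_{\mathbf T}$ and $\kappa^{-1}C_0|\omega_P|\le{\rm dist}(\xi_{\mathbf T},\omega_P)\le\kappa C_0|\omega_P|$, and such that $\omega_P=\omega_{P'}$ whenever $P,P'\in\mathbf T$ and $|I_P|=|I_{P'}|$. Two lacunary trees $\mathbf T,\mathbf T'$ are *strongly disjoint* if $\mathbf T\cap\mathbf T'=\emptyset$ and, whenever $P\in\mathbf T$, $P'\in\mathbf T'$ satisfy $\omega_P\subsetneq\omega_{P'}$, one has $I_{\mathbf T}\cap I_{P'}=\emptyset$, and similarly with $\mathbf T$ and $\mathbf T'$ reversed. A *forest* is a collection $\mathcal F$ of lacunary trees any two distinct members of which are strongly disjoint. Claim. There is a constant $C>0$, depending only on $N,C_0,\kappa,B$, such that the following holds. Let $\mathcal F$ be a forest, let $\mathbf P=\bigcup_{\mathbf T\in\mathcal F}\mathbf T$, let $M\ge0$ be a real number with $$\Big\|\sum_{\mathbf T\in\mathcal F}1_{I_{\mathbf T}}\Big\|_{L^\infty(\mathbf R)}\le M,$$ and for each $P\in\mathbf P$ let $\psi_P$ be a wave packet adapted to $P$. Then for every $a=(a_P)_{P\in\mathbf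 P}\in\ell^2(\mathbf P)$ the series $\sum_{P\in\mathbf P}a_P\psi_P$ converges unconditionally in $L^2(\mathbf R)$ (it is an ordinary finite sum, and $a$ is an arbitrary sequence of complex numbers, when $\mathbf P$ is finite), and $$\Big\|\sum_{P\in\mathbf P}a_P\psi_P\Big\|_{L^2(\mathbf R)}\le C\,\log(2+M)\,\|a\|_{\ell^2}.$$ -/

import Mathlib

open MeasureTheory Set
open scoped FourierTransform ENNReal

noncomputable section

namespace WavePackets

/-- The dyadic interval `[2^i l, 2^i (l+1))` of the standard grid; the pair `(i, l)` is determined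
by the interval. -/
structure DyadicInterval where
  i : ℤ
  l : ℤ

namespace DyadicInterval

/-- The length `|I|`. -/
def length (I : DyadicInterval) : ℝ := (2 : ℝ) ^ I.i

/-- The left endpoint. -/
def left (I : DyadicInterval) : ℝ := (2 : ℝ) ^ I.i * I.l

/-- The center `c(I)`. -/
def center (I : DyadicInterval) : ℝ := I.left + I.length / 2

/-- The underlying set of points. -/
def toSet (I : DyadicInterval) : Set ℝ := Ico I.left (I.left + I.length)

/-- The (closed) interval `C I` with the same center as `I` and `C` times its length. -/
def dilate (C : ℝ) (I : DyadicInterval) : Set ℝ :=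
  Icc (I.center - C * I.length / 2) (I.center + C * I.length / 2)

/-- The weight `χ_I(x) = (1 + (x - c(I))² / |I|²)^(-1/2)`. -/
def weight (I : DyadicInterval) (x : ℝ) : ℝ :=
  (1 + (x - I.center) ^ 2 / I.length ^ 2) ^ (-(1 / 2) : ℝ)

theorem length_pos (I : DyadicInterval) : 0 < I.length := zpow_pos (by norm_num) _

end DyadicInterval

/-- A tile `P = I_P × ω_P`. -/
structure Tile where
  /-- the time interval `I_P` -/
  I : DyadicInterval
  /-- the frequency interval `ω_P` -/
  ω : DyadicInterval
  heisenberg : I.length * ω.length = 1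

/-- `ψ` is a wave packet adapted to `P`, with decay parameter `N` and implied constant `B`. -/
structure IsWavePacket (N : ℕ) (B : ℝ) (P : Tile) (ψ : ℝ → ℂ) : Prop where
  aestronglyMeasurable : AEStronglyMeasurable ψ volume
  fourier_support : Function.support (𝓕 ψ) ⊆ P.ω.dilate 0.8
  bound : ∀ x, ‖ψ x‖ ≤ B * P.I.length ^ (-(1 / 2) : ℝ) * P.I.weight x ^ (10 * N)

/-- A lacunary tree `(T, I_T, ξ_T)`.  The relation `dist(ω_P, ξ_T) ∼ C₀ |ω_P|` is taken with
implied constant `κ`. -/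
structure LacunaryTree (C₀ κ : ℝ) where
  /-- the collection of tiles -/
  tiles : Set Tile
  /-- the time interval `I_T` -/
  I : DyadicInterval
  /-- the center frequency `ξ_T` -/
  ξ : ℝ
  time_subset : ∀ P ∈ tiles, P.I.toSet ⊆ I.toSet
  lacunary : ∀ P ∈ tiles, κ⁻¹ * (C₀ * P.ω.length) ≤ Metric.infDist ξ P.ω.toSet ∧
    Metric.infDist ξ P.ω.toSet ≤ κ * (C₀ * P.ω.length)
  freq_eq : ∀ P ∈ tiles, ∀ P' ∈ tiles, P.I.length = P'.I.length → P.ω = P'.ω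

variable {C₀ κ : ℝ}

/-- Strong disjointness of two lacunary trees. -/
structure StronglyDisjoint (T T' : LacunaryTree C₀ κ) : Prop where
  disjoint : Disjoint T.tiles T'.tiles
  left : ∀ P ∈ T.tiles, ∀ P' ∈ T'.tiles,
    P.ω.toSet ⊂ P'.ω.toSet → Disjoint T.I.toSet P'.I.toSet
  right : ∀ P ∈ T.tiles, ∀ P' ∈ T'.tiles,
    P'.ω.toSet ⊂ P.ω.toSet → Disjoint T'.I.toSet P.I.toSet

/-- A forest: any two distinct trees of the collection are strongly disjoint. -/
def IsForest (F : Set (LacunaryTree C₀ κ)) : Prop := F.Pairwise StronglyDisjoint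

/-- The set of all tiles of the trees in `F`. -/
def forestTiles (F : Set (LacunaryTree C₀ κ)) : Set Tile := ⋃ T ∈ F, T.tiles

/-- The counting function `∑_{T ∈ F} 1_{I_T}`. -/
def countingFunction (F : Set (LacunaryTree C₀ κ)) (x : ℝ) : ℝ≥0∞ :=
  ∑' T : F, T.1.I.toSet.indicator 1 x

theorem DyadicInterval.weight_nonneg (I : DyadicInterval) (x : ℝ) : 0 ≤ I.weight x :=
  Real.rpow_nonneg (by positivity) _

theorem DyadicInterval.weight_le_one (I : DyadicInterval) (x : ℝ) : I.weight x ≤ 1 :=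
  Real.rpow_le_one_of_one_le_of_nonpos (le_add_of_nonneg_right (by positivity)) (by norm_num)

theorem DyadicInterval.weight_sq (I : DyadicInterval) (x : ℝ) :
    I.weight x ^ 2 = (1 + ((x - I.center) / I.length) ^ 2)⁻¹ := by
  unfold weight
  rw [← Real.rpow_natCast, ← Real.rpow_mul (by positivity), div_pow]
  norm_num [Real.rpow_neg_one]

/-- A wave packet is square integrable, so that it defines an element of `L²(ℝ)`. -/
theorem IsWavePacket.memLp {N : ℕ} (hN : 1 ≤ N) {B : ℝ} {P : Tile} {ψ : ℝ → ℂ}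
    (h : IsWavePacket N B P ψ) : MemLp ψ 2 volume := by
  rw [memLp_two_iff_integrable_sq_norm h.aestronglyMeasurable]
  have hint : Integrable (fun x : ℝ => (B * P.I.length ^ (-(1 / 2) : ℝ)) ^ 2 *
      (1 + ((x - P.I.center) / P.I.length) ^ 2)⁻¹) :=
    (((integrable_inv_one_add_sq.comp_div P.I.length_pos.ne').comp_sub_right
      P.I.center)).const_mul _
  refine hint.mono' (h.aestronglyMeasurable.norm.pow 2) (Filter.Eventually.of_forall fun x => ?_)
  have h1 : P.I.weight x ^ (10 * N) ≤ P.I.weight x ^ 1 :=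
    pow_le_pow_of_le_one (P.I.weight_nonneg x) (P.I.weight_le_one x) (by omega)
  have h2 := P.I.weight_nonneg x
  rw [Real.norm_of_nonneg (by positivity), ← P.I.weight_sq, ← mul_pow]
  have h3 := h.bound x
  have h4 : 0 ≤ P.I.weight x ^ (10 * N) := by positivity
  have h5 : ‖ψ x‖ ≤ |B * P.I.length ^ (-(1 / 2) : ℝ)| * P.I.weight x :=
    h3.trans ((mul_le_mul_of_nonneg_right (le_abs_self _) h4).trans
      (mul_le_mul_of_nonneg_left (by simpa using h1) (abs_nonneg _)))
  calc ‖ψ x‖ ^ 2 ≤ (|B * P.I.length ^ (-(1 / 2) : ℝ)| * P.I.weight x) ^ 2 := by gcongr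
    _ = _ := by rw [mul_pow, mul_pow, sq_abs]

end WavePackets

end

noncomputable section

namespace WavePackets

/-! Expand the square of the norm. Tiles with disjoint frequency intervals give orthogonal wave
packets, so only pairs with ω_P ⊆ ω_Q survive, and for these |I_Q| ≤ |I_P|. With z_P = |a_P|
|I_P|^(-1/2), such a pair contributes at most a constant times z_P z_Q |I_Q| χ_{I_P}(c(I_Q))^6, to
be compared with ∑ z_P² |I_P| = ‖a‖².

For fixed P, the tiles Q with ω_P ⊆ ω_Q have time intervals of bounded overlap (`card_above_le`):
strong disjointness forces two of them that share a time point and have distinct frequency intervals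
into one tree, where lacunarity leaves few scales. This settles the pairs with z_Q ≲ z_P. Pairs in
one tree or with one frequency interval have comparable scales and are summed over P instead
(`sum_near_le`).

There remain the far pairs with z_P smaller than z_Q. Here I_Q misses the top interval of the tree
of P, so the interaction decays as I_P moves away from the boundary of that top interval. Tiles
discounted in this way satisfy a Carleson packing condition with constant M (`sum_edgeWeight_le`),
and using it twice bounds the third moment of the far interaction by M²
(`sum_length_mul_farSum_cube_le`).

Between levels z_P ~ 8^m and z_Q ~ 8^m' with m < m', a second moment would only be scale invariant,
whereas the third moment leaves a gain 2^(m-m') against the loss M² (`sum_far_levels_le`). Levels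
spaced by L ≥ 2 log₂ M therefore interact boundedly. Splitting the levels into residue classes mod L
and using the triangle inequality costs the factor L ~ log(2+M). -/

/-! ### Fourier inversion and orthogonality -/

theorem integral_fourier_mul_eq {f g : ℝ → ℂ} (hf : Integrable f) (hg : Integrable g) :
    ∫ x, 𝓕 f x * g x = ∫ x, f x * 𝓕 g x := by
  simpa using! VectorFourier.integral_fourierIntegral_smul_eq_flip (L := innerₗ ℝ)
    Real.continuous_fourierChar continuous_inner hf hg

theorem integral_fourierInv_mul_eq {f g : ℝ → ℂ} (hf : Integrable f) (hg : Integrable g) :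
    ∫ x, 𝓕⁻ f x * g x = ∫ x, f x * 𝓕⁻ g x := by
  have h := VectorFourier.integral_fourierIntegral_smul_eq_flip (L := -innerₗ ℝ)
    Real.continuous_fourierChar (by simp; fun_prop) hf hg
  have hflip : (-innerₗ ℝ).flip = -innerₗ ℝ := by
    ext
    simp
  simp only [hflip] at h
  simpa [VectorFourier.fourierIntegral, Real.fourierInv_eq] using! h

theorem integral_conj_fourier_mul_eq {f g : ℝ → ℂ} (hf : Integrable f) (hg : Integrable g) :
    ∫ x, inner ℂ (𝓕 f x) (g x) = ∫ x, inner ℂ (f x) (𝓕⁻ g x) := by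
  have h := VectorFourier.integral_sesq_fourierIntegral_eq_neg_flip (L := innerₗ ℝ)
    (innerSL ℂ (E := ℂ)) Real.continuous_fourierChar continuous_inner hf hg
  have hflip : -(innerₗ ℝ).flip = -innerₗ ℝ := by
    ext
    simp
  simp only [hflip] at h
  simpa [VectorFourier.fourierIntegral, Real.fourierInv_eq, Real.fourier_eq] using! h

theorem continuous_fourier {f : ℝ → ℂ} (hf : Integrable f) : Continuous (𝓕 f) :=
  VectorFourier.fourierIntegral_continuous Real.continuous_fourierChar
    (L := innerₗ ℝ) continuous_inner hf

theorem continuous_fourierInv {f : ℝ → ℂ} (hf : Integrable f) : Continuous (𝓕⁻ f) := by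
  have h : 𝓕⁻ f = fun x => 𝓕 f (-x) := funext fun x => Real.fourierInv_eq_fourier_neg f x
  rw [h]
  exact (continuous_fourier hf).comp continuous_neg

/-- Fourier inversion almost everywhere, without continuity of the function. -/
theorem ae_eq_fourierInv_fourier {f : ℝ → ℂ} (hf : Integrable f) (hf' : Integrable (𝓕 f)) :
    f =ᵐ[volume] 𝓕⁻ (𝓕 f) := by
  refine ae_eq_of_integral_contDiff_smul_eq hf.locallyIntegrable
    (continuous_fourierInv hf').locallyIntegrable fun η hη hηc => ?_
  have hc : HasCompactSupport fun x => (η x : ℂ) := hηc.comp_left (g := Complex.ofReal) rfl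
  have hd : ContDiff ℝ (⊤ : ℕ∞) fun x => (η x : ℂ) := Complex.ofRealCLM.contDiff.comp hη
  let s : SchwartzMap ℝ ℂ := hc.toSchwartzMap hd
  have hs : ∀ x, s x = (η x : ℂ) := fun x => rfl
  have h1 : 𝓕 (𝓕⁻ s : SchwartzMap ℝ ℂ) = s := FourierTransform.fourier_fourierInv_eq s
  -- Moving the transform across twice turns ∫ f η into ∫ 𝓕⁻(𝓕 f) η.
  have h2 := integral_fourier_mul_eq hf (𝓕⁻ s : SchwartzMap ℝ ℂ).integrable
  have h3 := integral_fourierInv_mul_eq hf' s.integrable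
  rw [← SchwartzMap.fourier_coe, h1] at h2
  rw [← SchwartzMap.fourierInv_coe, h2] at h3
  simp only [hs] at h3
  simpa [mul_comm] using h3.symm

/-- Parseval, obtained by inverting only `g`; the transform of `f` need not be integrable. -/
theorem integral_inner_eq_zero {f g : ℝ → ℂ} (hf : Integrable f) (hg : Integrable g)
    (hg' : Integrable (𝓕 g)) (h : ∀ ξ, 𝓕 f ξ = 0 ∨ 𝓕 g ξ = 0) :
    ∫ x, inner ℂ (f x) (g x) = 0 := by
  have h1 : ∫ x, inner ℂ (f x) (g x) = ∫ x, inner ℂ (f x) (𝓕⁻ (𝓕 g) x) := by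
    refine integral_congr_ae ?_
    filter_upwards [ae_eq_fourierInv_fourier hg hg'] with x hx
    rw [← hx]
  rw [h1, ← integral_conj_fourier_mul_eq hf hg']
  have h2 : (fun ξ => inner ℂ (𝓕 f ξ) (𝓕 g ξ)) = fun _ => 0 := by
    funext ξ
    rcases h ξ with h | h <;> simp [h]
  rw [h2, integral_zero]

/-! ### Dyadic intervals and the slowly varying weight -/

namespace DyadicInterval

theorem mem_toSet {I : DyadicInterval} {x : ℝ} :
    x ∈ I.toSet ↔ I.left ≤ x ∧ x < I.left + I.length := Iff.rfl

theorem center_mem (I : DyadicInterval) : I.center ∈ I.toSet := by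
  have := I.length_pos
  rw [mem_toSet, center]
  constructor <;> linarith

theorem length_le_iff {I J : DyadicInterval} : I.length ≤ J.length ↔ I.i ≤ J.i :=
  zpow_le_zpow_iff_right₀ (by norm_num)

theorem length_eq_iff {I J : DyadicInterval} : I.length = J.length ↔ I.i = J.i := by
  simp only [le_antisymm_iff, length_le_iff]

theorem ext_of_mem {I J : DyadicInterval} (h : I.i = J.i) {x : ℝ} (hI : x ∈ I.toSet)
    (hJ : x ∈ J.toSet) : I = J := by
  obtain ⟨i, l⟩ := I
  obtain ⟨j, m⟩ := J
  obtain rfl : i = j := h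
  have h2 : (0 : ℝ) < 2 ^ i := by positivity
  simp only [mem_toSet, left, length, ← mul_add_one] at hI hJ
  have h3 : (l : ℝ) < m + 1 := lt_of_mul_lt_mul_left (hI.1.trans_lt hJ.2) h2.le
  have h4 : (m : ℝ) < l + 1 := lt_of_mul_lt_mul_left (hJ.1.trans_lt hI.2) h2.le
  norm_cast at h3 h4
  congr
  omega

theorem toSet_subset_of_mem {I J : DyadicInterval} (h : I.i ≤ J.i) {x : ℝ} (hI : x ∈ I.toSet)
    (hJ : x ∈ J.toSet) : I.toSet ⊆ J.toSet := by
  obtain ⟨i, l⟩ := I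
  obtain ⟨j, m⟩ := J
  obtain ⟨d, rfl⟩ : ∃ d : ℕ, j = i + d := ⟨(j - i).toNat, by simp at h; omega⟩
  have h2 : (0 : ℝ) < 2 ^ i := by positivity
  simp only [mem_toSet, left, length, ← mul_add_one] at hI hJ
  rw [zpow_add₀ (by norm_num), mul_assoc, mul_assoc, zpow_natCast] at hJ
  have h3 : (l : ℝ) < 2 ^ d * (m + 1) := lt_of_mul_lt_mul_left (hI.1.trans_lt hJ.2) h2.le
  have h4 : (2 ^ d * m : ℝ) < l + 1 := lt_of_mul_lt_mul_left (hJ.1.trans_lt hI.2) h2.le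
  have h5 : (l : ℝ) + 1 ≤ 2 ^ d * (m + 1) := by exact_mod_cast h3
  have h6 : (2 ^ d * m : ℝ) ≤ l := by
    have : 2 ^ d * m < l + 1 := by exact_mod_cast h4
    exact_mod_cast Int.lt_add_one_iff.mp this
  intro y hy
  simp only [mem_toSet, left, length, ← mul_add_one] at hy ⊢
  rw [zpow_add₀ (by norm_num), mul_assoc, mul_assoc, zpow_natCast]
  exact ⟨(mul_le_mul_of_nonneg_left h6 h2.le).trans hy.1,
    hy.2.trans_le (mul_le_mul_of_nonneg_left h5 h2.le)⟩

theorem toSet_subset_or_subset {I J : DyadicInterval} {x : ℝ} (hI : x ∈ I.toSet)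
    (hJ : x ∈ J.toSet) : I.toSet ⊆ J.toSet ∨ J.toSet ⊆ I.toSet :=
  (le_total I.i J.i).imp (fun h => toSet_subset_of_mem h hI hJ)
    fun h => toSet_subset_of_mem h hJ hI

theorem volume_toSet (I : DyadicInterval) : volume I.toSet = ENNReal.ofReal I.length := by
  simp [toSet]

theorem measurableSet_toSet (I : DyadicInterval) : MeasurableSet I.toSet := measurableSet_Ico

theorem le_of_toSet_subset {I J : DyadicInterval} (h : I.toSet ⊆ J.toSet) :
    I.length ≤ J.length := by
  have h1 := measure_mono (μ := volume) h
  rw [volume_toSet, volume_toSet] at h1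
  exact (ENNReal.ofReal_le_ofReal_iff J.length_pos.le).mp h1

theorem eq_of_subset_of_i_eq {I J : DyadicInterval} (h : I.toSet ⊆ J.toSet) (hi : I.i = J.i) :
    I = J :=
  ext_of_mem hi I.center_mem (h I.center_mem)

theorem left_le_of_subset {I J : DyadicInterval} (h : I.toSet ⊆ J.toSet) :
    J.left ≤ I.left ∧ I.left + I.length ≤ J.left + J.length :=
  (Ico_subset_Ico_iff (by linarith [I.length_pos])).mp h

theorem dilate_subset (I : DyadicInterval) : I.dilate 0.8 ⊆ I.toSet := by
  intro x hx
  have := I.length_pos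
  simp only [dilate, mem_Icc, center] at hx
  rw [mem_toSet]
  constructor <;> linarith

/-- The dyadic interval of length `2 ^ j` containing `x`. -/
def containing (j : ℤ) (x : ℝ) : DyadicInterval := ⟨j, ⌊x / 2 ^ j⌋⟩

theorem mem_containing (j : ℤ) (x : ℝ) : x ∈ (containing j x).toSet := by
  have h2 : (0 : ℝ) < 2 ^ j := by positivity
  simp only [mem_toSet, left, length, ← mul_add_one, containing]
  have h3 := Int.floor_le (x / 2 ^ j)
  have h4 := Int.lt_floor_add_one (x / 2 ^ j)
  rw [le_div_iff₀ h2] at h3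
  rw [div_lt_iff₀ h2] at h4
  constructor <;> linarith

/-- The square of the weight `χ_I`. -/
def sqWeight (I : DyadicInterval) (x : ℝ) : ℝ := (1 + ((x - I.center) / I.length) ^ 2)⁻¹

theorem sqWeight_pos (I : DyadicInterval) (x : ℝ) : 0 < I.sqWeight x := by
  unfold sqWeight
  positivity

theorem sqWeight_nonneg (I : DyadicInterval) (x : ℝ) : 0 ≤ I.sqWeight x := (I.sqWeight_pos x).le

theorem sqWeight_le_one (I : DyadicInterval) (x : ℝ) : I.sqWeight x ≤ 1 :=
  inv_le_one_of_one_le₀ (le_add_of_nonneg_right (by positivity))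

theorem integrable_sqWeight (I : DyadicInterval) : Integrable I.sqWeight :=
  (integrable_inv_one_add_sq.comp_div I.length_pos.ne').comp_sub_right I.center

theorem integral_sqWeight (I : DyadicInterval) : ∫ x, I.sqWeight x = Real.pi * I.length := by
  unfold sqWeight
  rw [integral_sub_right_eq_self (fun x : ℝ => (1 + (x / I.length) ^ 2)⁻¹) I.center,
    Measure.integral_comp_div (fun x : ℝ => (1 + x ^ 2)⁻¹) I.length,
    integral_univ_inv_one_add_sq, abs_of_pos I.length_pos, smul_eq_mul, mul_comm]

/-- Triangle inequality through y: being far from c(J) on the scale of I forces y to be far from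
c(I) or from c(J). This moves an evaluation point to the center of the other interval. -/
theorem sqWeight_mul_le {I J : DyadicInterval} {μ : ℝ} (hμ : 1 ≤ μ)
    (h : J.length ≤ μ * I.length) (y : ℝ) :
    I.sqWeight y * J.sqWeight y ≤ 2 * μ ^ 2 * I.sqWeight J.center := by
  have hI := I.length_pos
  have hJ := J.length_pos
  have key : (1 + ((J.center - I.center) / I.length) ^ 2) ≤
      2 * μ ^ 2 * ((1 + ((y - I.center) / I.length) ^ 2) *
        (1 + ((y - J.center) / J.length) ^ 2)) := by
    set a := (y - I.center) / I.length
    set b := (y - J.center) / J.length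
    have h1 : (J.center - I.center) / I.length = a - b * (J.length / I.length) := by
      simp only [a, b]
      field_simp
      ring
    have h2 : J.length / I.length ≤ μ := (div_le_iff₀ hI).mpr h
    have h3 : 0 ≤ J.length / I.length := by positivity
    rw [h1]
    set t := J.length / I.length
    have h4 : t ^ 2 ≤ μ ^ 2 := by gcongr
    have h5 : (b * t) ^ 2 ≤ μ ^ 2 * b ^ 2 := by
      rw [mul_pow, mul_comm]
      gcongr
    have h6 : (1 : ℝ) ≤ μ ^ 2 := one_le_pow₀ hμ
    nlinarith [sq_nonneg (a + b * t), mul_nonneg (sq_nonneg a) (sq_nonneg b), sq_nonneg a,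
      mul_nonneg (sub_nonneg.mpr h6) (sq_nonneg a),
      mul_nonneg (sq_nonneg μ) (mul_nonneg (sq_nonneg a) (sq_nonneg b))]
  unfold sqWeight
  rw [← mul_inv, ← div_eq_mul_inv, inv_eq_one_div, div_le_div_iff₀ (by positivity) (by positivity),
    one_mul]
  exact key

/-- The weight varies slowly on intervals of comparable or smaller length. -/
theorem sqWeight_le_of_mem {I J : DyadicInterval} {μ : ℝ} (hμ : 1 ≤ μ)
    (h : J.length ≤ μ * I.length) {x y : ℝ} (hx : x ∈ J.toSet) (hy : y ∈ J.toSet) :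
    I.sqWeight x ≤ 4 * μ ^ 2 * I.sqWeight y := by
  have hI := I.length_pos
  have hJ := J.length_pos
  have key : 1 + ((y - I.center) / I.length) ^ 2 ≤
      4 * μ ^ 2 * (1 + ((x - I.center) / I.length) ^ 2) := by
    set a := (x - I.center) / I.length with ha
    have h1 : (y - I.center) / I.length = a + (y - x) / I.length := by
      simp only [a]
      field_simp
      ring
    have h2 : |(y - x) / I.length| ≤ μ := by
      rw [abs_div, abs_of_pos hI, div_le_iff₀ hI]
      refine le_trans ?_ h
      rw [abs_le]
      rw [mem_toSet] at hx hy
      constructor <;> linarith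
    rw [h1]
    set t := (y - x) / I.length
    have h4 : t ^ 2 ≤ μ ^ 2 := sq_le_sq' (by linarith [abs_le.mp h2]) (abs_le.mp h2).2
    have h6 : (1 : ℝ) ≤ μ ^ 2 := one_le_pow₀ hμ
    nlinarith [sq_nonneg (a - t), mul_nonneg (sub_nonneg.mpr h6) (sq_nonneg a), sq_nonneg a]
  unfold sqWeight
  rw [inv_eq_one_div, ← div_eq_mul_inv, div_le_div_iff₀ (by positivity) (by positivity), one_mul]
  exact key

end DyadicInterval

/-! ### Tiles and correlations of wave packets -/

theorem Tile.ext_of_freq {P Q : Tile} (h : P.ω = Q.ω) {x : ℝ} (hP : x ∈ P.I.toSet)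
    (hQ : x ∈ Q.I.toSet) : P = Q := by
  have h1 : P.I.length = Q.I.length := by
    have := P.heisenberg
    have h2 := Q.heisenberg
    rw [h] at this
    exact mul_right_cancel₀ Q.ω.length_pos.ne' (this.trans h2.symm)
  have h2 : P.I = Q.I := DyadicInterval.ext_of_mem (DyadicInterval.length_eq_iff.mp h1) hP hQ
  obtain ⟨I, ω, _⟩ := P
  obtain ⟨J, ω', _⟩ := Q
  simp only at h h2
  subst h h2
  rfl

theorem Tile.i_add (P : Tile) : P.I.i + P.ω.i = 0 := by
  have h := P.heisenberg
  unfold DyadicInterval.length at h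
  rw [← zpow_add₀ (by norm_num)] at h
  exact (zpow_eq_one_iff_right₀ (by norm_num) (by norm_num)).mp h

theorem Tile.length_le_of_freq_subset {P Q : Tile} (h : P.ω.toSet ⊆ Q.ω.toSet) :
    Q.I.length ≤ P.I.length := by
  have h1 := DyadicInterval.length_le_iff.mp (DyadicInterval.le_of_toSet_subset h)
  have := P.i_add
  have := Q.i_add
  exact DyadicInterval.length_le_iff.mpr (by omega)

namespace IsWavePacket

variable {N : ℕ} {B : ℝ} {P Q : Tile} {ψ φ : ℝ → ℂ}

theorem norm_mul_sqrt_le (hN : 1 ≤ N) (h : IsWavePacket N B P ψ) (x : ℝ) :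
    ‖ψ x‖ * √P.I.length ≤ |B| * P.I.sqWeight x ^ 5 := by
  have h1 := h.bound x
  have hl := P.I.length_pos
  have h2 : P.I.weight x ^ (10 * N) ≤ P.I.sqWeight x ^ 5 := by
    have : P.I.sqWeight x = P.I.weight x ^ 2 := (P.I.weight_sq x).symm
    rw [this, ← pow_mul]
    exact pow_le_pow_of_le_one (P.I.weight_nonneg x) (P.I.weight_le_one x) (by omega)
  have h3 : P.I.length ^ (-(1 / 2) : ℝ) = (√P.I.length)⁻¹ := by
    rw [Real.rpow_neg hl.le, Real.sqrt_eq_rpow]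
  rw [h3] at h1
  have h4 : 0 < √P.I.length := Real.sqrt_pos.mpr hl
  have h5 : 0 ≤ P.I.weight x ^ (10 * N) := pow_nonneg (P.I.weight_nonneg x) _
  calc ‖ψ x‖ * √P.I.length
      ≤ B * (√P.I.length)⁻¹ * P.I.weight x ^ (10 * N) * √P.I.length := by gcongr
    _ = B * P.I.weight x ^ (10 * N) := by field_simp
    _ ≤ |B| * P.I.weight x ^ (10 * N) := by gcongr; exact le_abs_self B
    _ ≤ _ := by gcongr

theorem integrable (hN : 1 ≤ N) (h : IsWavePacket N B P ψ) : Integrable ψ := by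
  have hl : 0 < √P.I.length := Real.sqrt_pos.mpr P.I.length_pos
  refine (P.I.integrable_sqWeight.const_mul (|B| / √P.I.length)).mono' h.aestronglyMeasurable
    (Filter.Eventually.of_forall fun x => ?_)
  have h1 := h.norm_mul_sqrt_le hN x
  rw [div_mul_eq_mul_div, le_div_iff₀ hl]
  refine h1.trans ?_
  gcongr
  exact pow_le_of_le_one (P.I.sqWeight_nonneg x) (P.I.sqWeight_le_one x) (by norm_num)

theorem integrable_fourier (hN : 1 ≤ N) (h : IsWavePacket N B P ψ) : Integrable (𝓕 ψ) :=
  (continuous_fourier (h.integrable hN)).integrable_of_hasCompactSupport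
    (HasCompactSupport.of_support_subset_isCompact isCompact_Icc h.fourier_support)

/-- Wave packets whose frequency intervals are not nested are orthogonal. -/
theorem integral_inner_eq_zero (hN : 1 ≤ N) (hψ : IsWavePacket N B P ψ)
    (hφ : IsWavePacket N B Q φ) (h1 : ¬ P.ω.toSet ⊆ Q.ω.toSet) (h2 : ¬ Q.ω.toSet ⊆ P.ω.toSet) :
    ∫ x, inner ℂ (ψ x) (φ x) = 0 := by
  refine WavePackets.integral_inner_eq_zero (hψ.integrable hN) (hφ.integrable hN)
    (hφ.integrable_fourier hN) fun ξ => ?_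
  by_contra! hξ
  have h3 := P.ω.dilate_subset (hψ.fourier_support (Function.mem_support.mpr hξ.1))
  have h4 := Q.ω.dilate_subset (hφ.fourier_support (Function.mem_support.mpr hξ.2))
  exact (DyadicInterval.toSet_subset_or_subset h3 h4).elim h1 h2

theorem norm_integral_inner_le (hN : 1 ≤ N) (hψ : IsWavePacket N B P ψ)
    (hφ : IsWavePacket N B Q φ) (hPQ : Q.I.length ≤ P.I.length) :
    √P.I.length * √Q.I.length * ‖∫ x, inner ℂ (ψ x) (φ x)‖ ≤
      16 * Real.pi * B ^ 2 * (Q.I.length * P.I.sqWeight Q.I.center ^ 3) := by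
  have hP : 0 < √P.I.length := Real.sqrt_pos.mpr P.I.length_pos
  have hQ : 0 < √Q.I.length := Real.sqrt_pos.mpr Q.I.length_pos
  have hs := P.I.sqWeight_nonneg Q.I.center
  set K : ℝ := B ^ 2 * (16 * P.I.sqWeight Q.I.center ^ 3) / (√P.I.length * √Q.I.length) with hK
  have hpt : ∀ x, ‖inner ℂ (ψ x) (φ x)‖ ≤ K * Q.I.sqWeight x := by
    intro x
    have h1 := hψ.norm_mul_sqrt_le hN x
    have h2 := hφ.norm_mul_sqrt_le hN x
    have h3 := P.I.sqWeight_nonneg x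
    have h4 := Q.I.sqWeight_nonneg x
    have h5 : P.I.sqWeight x * Q.I.sqWeight x ≤ 2 * P.I.sqWeight Q.I.center := by
      simpa using DyadicInterval.sqWeight_mul_le le_rfl (by simpa using hPQ) x
    -- Of the five available powers four produce decay in the separation; the fifth is kept to
    -- integrate in x.
    have h6 : (P.I.sqWeight x * Q.I.sqWeight x) ^ 4 ≤ 16 * P.I.sqWeight Q.I.center ^ 3 :=
      calc (P.I.sqWeight x * Q.I.sqWeight x) ^ 4 ≤ (2 * P.I.sqWeight Q.I.center) ^ 4 := by gcongr
        _ = 16 * P.I.sqWeight Q.I.center ^ 4 := by ring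
        _ ≤ _ := by
          gcongr 16 * ?_
          exact pow_le_pow_of_le_one hs (P.I.sqWeight_le_one _) (by norm_num)
    rw [hK, div_mul_eq_mul_div, le_div_iff₀ (by positivity)]
    calc ‖inner ℂ (ψ x) (φ x)‖ * (√P.I.length * √Q.I.length)
        ≤ (‖ψ x‖ * ‖φ x‖) * (√P.I.length * √Q.I.length) := by
          gcongr
          exact norm_inner_le_norm _ _
      _ = (‖ψ x‖ * √P.I.length) * (‖φ x‖ * √Q.I.length) := by ring
      _ ≤ (|B| * P.I.sqWeight x ^ 5) * (|B| * Q.I.sqWeight x ^ 5) := by gcongr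
      _ = B ^ 2 * ((P.I.sqWeight x * Q.I.sqWeight x) ^ 4 *
          (P.I.sqWeight x * Q.I.sqWeight x)) := by rw [← sq_abs B]; ring
      _ ≤ B ^ 2 * (16 * P.I.sqWeight Q.I.center ^ 3 * (1 * Q.I.sqWeight x)) := by
          gcongr
          exact P.I.sqWeight_le_one x
      _ = _ := by ring
  have h := norm_integral_le_of_norm_le (Q.I.integrable_sqWeight.const_mul K)
    (Filter.Eventually.of_forall hpt)
  rw [integral_const_mul, Q.I.integral_sqWeight] at h
  calc √P.I.length * √Q.I.length * ‖∫ x, inner ℂ (ψ x) (φ x)‖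
      ≤ √P.I.length * √Q.I.length * (K * (Real.pi * Q.I.length)) := by gcongr
    _ = _ := by
      rw [hK]
      field_simp

end IsWavePacket

/-! ### Weighted sums over intervals of bounded overlap -/

open scoped Classical in
/-- A weighted sum of values of the slowly varying weight is controlled by the overlap of the
intervals that carry the values. -/
theorem sum_mul_sqWeight_le {ι : Type*} (s : Finset ι) (J : ι → DyadicInterval) (c w : ι → ℝ)
    (I : DyadicInterval) {μ K : ℝ} (hμ : 1 ≤ μ) (hc : ∀ i ∈ s, c i ∈ (J i).toSet)
    (hw : ∀ i ∈ s, 0 ≤ w i) (hl : ∀ i ∈ s, (J i).length ≤ μ * I.length)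
    (hK : ∀ y, ∑ i ∈ s with y ∈ (J i).toSet, w i / (J i).length ≤ K) :
    ∑ i ∈ s, w i * I.sqWeight (c i) ≤ 4 * μ ^ 2 * Real.pi * K * I.length := by
  set f : ι → ℝ → ℝ := fun i => (J i).toSet.indicator fun y =>
    w i / (J i).length * (4 * μ ^ 2 * I.sqWeight y) with hf
  have hint : ∀ i, Integrable (f i) := fun i =>
    ((I.integrable_sqWeight.const_mul _).const_mul _).indicator (J i).measurableSet_toSet
  -- The weight varies slowly on `J i`, so its value at `c i` is replaced by an average over `J i`;
  -- the overlap bound then applies under the integral.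
  have h1 : ∀ i ∈ s, w i * I.sqWeight (c i) ≤ ∫ y, f i y := by
    intro i hi
    have hJ := (J i).length_pos
    have h2 : ∫ y, (J i).toSet.indicator (fun _ => w i / (J i).length * I.sqWeight (c i)) y =
        w i * I.sqWeight (c i) := by
      rw [integral_indicator_const _ (J i).measurableSet_toSet, measureReal_def,
        DyadicInterval.volume_toSet, ENNReal.toReal_ofReal hJ.le, smul_eq_mul]
      field_simp
    rw [← h2]
    refine integral_mono ?_ (hint i) fun y => ?_
    · exact (integrable_indicator_iff (J i).measurableSet_toSet).mpr
        (integrableOn_const (by simp [DyadicInterval.volume_toSet]))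
    · refine indicator_le_indicator' fun hy => ?_
      exact mul_le_mul_of_nonneg_left
        (DyadicInterval.sqWeight_le_of_mem hμ (hl i hi) (hc i hi) hy)
        (div_nonneg (hw i hi) hJ.le)
  calc ∑ i ∈ s, w i * I.sqWeight (c i) ≤ ∑ i ∈ s, ∫ y, f i y := Finset.sum_le_sum h1
    _ = ∫ y, ∑ i ∈ s, f i y := (integral_finsetSum _ fun i _ => hint i).symm
    _ ≤ ∫ y, K * (4 * μ ^ 2 * I.sqWeight y) := by
      refine integral_mono (integrable_finsetSum _ fun i _ => hint i)
        ((I.integrable_sqWeight.const_mul _).const_mul _) fun y => ?_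
      have h3 := mul_nonneg (mul_nonneg zero_le_four (sq_nonneg μ)) (I.sqWeight_nonneg y)
      refine le_trans (le_of_eq ?_) (mul_le_mul_of_nonneg_right (hK y) h3)
      rw [Finset.sum_mul, Finset.sum_filter]
      refine Finset.sum_congr rfl fun i _ => ?_
      simp only [hf, indicator_apply]
    _ = _ := by
      rw [integral_const_mul, integral_const_mul, I.integral_sqWeight]
      ring

open scoped Classical in
theorem sum_length_mul_sqWeight_le (s : Finset Tile) (I : DyadicInterval) {μ : ℝ} {K : ℕ}
    (hμ : 1 ≤ μ) (hl : ∀ P ∈ s, P.I.length ≤ μ * I.length)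
    (hK : ∀ y, (s.filter fun P => y ∈ P.I.toSet).card ≤ K) :
    ∑ P ∈ s, P.I.length * I.sqWeight P.I.center ≤ 4 * μ ^ 2 * Real.pi * K * I.length := by
  refine sum_mul_sqWeight_le s (fun P => P.I) (fun P => P.I.center) (fun P => P.I.length) I hμ
    (fun P _ => P.I.center_mem) (fun P _ => P.I.length_pos.le) hl fun y => ?_
  rw [Finset.sum_congr rfl fun P _ => div_self P.I.length_pos.ne', Finset.sum_const, nsmul_eq_mul,
    mul_one]
  exact_mod_cast hK y

theorem card_le_of_scales (D : Finset Tile) {K : ℕ}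
    (hinj : ∀ P ∈ D, ∀ Q ∈ D, P.I.i = Q.I.i → P = Q)
    (hlt : ∀ P ∈ D, ∀ Q ∈ D, P.I.i < Q.I.i + K) : D.card ≤ K := by
  rcases D.eq_empty_or_nonempty with rfl | hne
  · simp
  obtain ⟨P₀, hP₀, hmin⟩ := D.exists_min_image (fun P => P.I.i) hne
  have h1 : D.card ≤ (Finset.Ico P₀.I.i (P₀.I.i + K)).card := by
    refine Finset.card_le_card_of_injOn (fun P => P.I.i) (fun P hP => ?_)
      fun P hP Q hQ h => hinj P hP Q hQ h
    simpa using ⟨hmin P hP, hlt P hP P₀ hP₀⟩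
  simpa using h1

/-! ### Bounded overlap from lacunarity and strong disjointness -/

section Forest

variable {C₀ κ : ℝ}

/-- Enlarging an interval decreases its distance to ξ_T, while lacunarity keeps that distance
comparable to the length. -/
theorem LacunaryTree.freq_length_le (T : LacunaryTree C₀ κ) (hC₀ : 0 < C₀) (hκ : 1 ≤ κ)
    {P Q : Tile} (hP : P ∈ T.tiles) (hQ : Q ∈ T.tiles) (h : P.ω.toSet ⊆ Q.ω.toSet) :
    Q.ω.length ≤ κ ^ 2 * P.ω.length := by
  have h1 := (T.lacunary Q hQ).1
  have h2 := (T.lacunary P hP).2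
  have h3 : Metric.infDist T.ξ Q.ω.toSet ≤ Metric.infDist T.ξ P.ω.toSet :=
    Metric.infDist_le_infDist_of_subset h ⟨_, P.ω.center_mem⟩
  have h4 := h1.trans (h3.trans h2)
  have hκ' : 0 < κ := by linarith
  rw [inv_mul_le_iff₀ hκ'] at h4
  refine le_of_mul_le_mul_left ?_ hC₀
  linarith

theorem LacunaryTree.length_le (T : LacunaryTree C₀ κ) (hC₀ : 0 < C₀) (hκ : 1 ≤ κ)
    {P Q : Tile} (hP : P ∈ T.tiles) (hQ : Q ∈ T.tiles) (h : P.ω.toSet ⊆ Q.ω.toSet) :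
    P.I.length ≤ κ ^ 2 * Q.I.length := by
  have h1 := T.freq_length_le hC₀ hκ hP hQ h
  have h2 := P.heisenberg
  have h3 := Q.heisenberg
  have h4 := P.I.length_pos
  have h5 := Q.I.length_pos
  calc P.I.length = P.I.length * (Q.I.length * Q.ω.length) := by rw [h3, mul_one]
    _ ≤ P.I.length * (Q.I.length * (κ ^ 2 * P.ω.length)) := by gcongr
    _ = (P.I.length * P.ω.length) * (κ ^ 2 * Q.I.length) := by ring
    _ = _ := by rw [h2, one_mul]

theorem LacunaryTree.scale_lt (T : LacunaryTree C₀ κ) (hC₀ : 0 < C₀) (hκ : 1 ≤ κ) {K : ℕ}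
    (hK : κ ^ 2 < 2 ^ K) {P Q : Tile} (hP : P ∈ T.tiles) (hQ : Q ∈ T.tiles)
    (h : P.ω.toSet ⊆ Q.ω.toSet) : P.I.i < Q.I.i + K := by
  have h1 := T.length_le hC₀ hκ hP hQ h
  have h2 : P.I.length < 2 ^ (Q.I.i + (K : ℤ)) := by
    rw [zpow_add₀ (by norm_num), zpow_natCast, mul_comm]
    exact h1.trans_lt (mul_lt_mul_of_pos_right hK Q.I.length_pos)
  exact (zpow_lt_zpow_iff_right₀ (by norm_num : (1 : ℝ) < 2)).mp h2

theorem LacunaryTree.eq_of_mem (T : LacunaryTree C₀ κ) {P Q : Tile} (hP : P ∈ T.tiles)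
    (hQ : Q ∈ T.tiles) (hi : P.I.i = Q.I.i) {y : ℝ} (hyP : y ∈ P.I.toSet) (hyQ : y ∈ Q.I.toSet) :
    P = Q :=
  Tile.ext_of_freq (T.freq_eq P hP Q hQ (DyadicInterval.length_eq_iff.mpr hi)) hyP hyQ

/-- `T` assigns to every tile of the finite set `S` a tree of the forest that contains it. -/
structure IsTreeAssignment (F : Set (LacunaryTree C₀ κ)) (S : Finset Tile)
    (T : Tile → LacunaryTree C₀ κ) : Prop where
  isForest : IsForest F
  mem_forest : ∀ P ∈ S, T P ∈ F
  mem_tiles : ∀ P ∈ S, P ∈ (T P).tiles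

/-- The pairs of tiles with nested frequency intervals that need no strong disjointness. -/
def Near (T : Tile → LacunaryTree C₀ κ) (P Q : Tile) : Prop :=
  P.ω.toSet ⊆ Q.ω.toSet ∧ (P.ω = Q.ω ∨ T P = T Q)

/-- The pairs of tiles with strictly nested frequency intervals in distinct trees. -/
def Far (T : Tile → LacunaryTree C₀ κ) (P Q : Tile) : Prop :=
  P.ω.toSet ⊆ Q.ω.toSet ∧ ¬ (P.ω = Q.ω ∨ T P = T Q)

namespace IsTreeAssignment

variable {F : Set (LacunaryTree C₀ κ)} {S : Finset Tile} {T : Tile → LacunaryTree C₀ κ}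

theorem disjoint_of_far (hT : IsTreeAssignment F S T) {P Q : Tile} (hP : P ∈ S) (hQ : Q ∈ S)
    (h : Far T P Q) : Disjoint (T P).I.toSet Q.I.toSet := by
  obtain ⟨h1, h2⟩ := h
  rw [not_or] at h2
  refine (hT.isForest (hT.mem_forest P hP) (hT.mem_forest Q hQ) h2.2).left P (hT.mem_tiles P hP) Q
    (hT.mem_tiles Q hQ) ⟨h1, fun h3 => h2.1 ?_⟩
  exact DyadicInterval.eq_of_subset_of_i_eq h1 (DyadicInterval.length_eq_iff.mp
    (le_antisymm (DyadicInterval.le_of_toSet_subset h1) (DyadicInterval.le_of_toSet_subset h3)))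

/-- If the trees and the frequency intervals both differed, strong disjointness would separate I_{T
P} from I_Q, contradicting the common point y. Within one tree lacunarity bounds the ratio of
scales. -/
theorem scale_lt_of_mem (hT : IsTreeAssignment F S T) (hC₀ : 0 < C₀) (hκ : 1 ≤ κ) {K : ℕ}
    (hK : κ ^ 2 < 2 ^ K) {P Q : Tile} (hP : P ∈ S) (hQ : Q ∈ S) {y : ℝ} (hyP : y ∈ P.I.toSet)
    (hyQ : y ∈ Q.I.toSet) (h : P.ω.toSet ⊆ Q.ω.toSet) : P.I.i < Q.I.i + K := by
  have hPQ : T P = T Q ∨ P.ω = Q.ω := by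
    by_contra hne
    have hd := hT.disjoint_of_far hP hQ ⟨h, fun h' => hne h'.symm⟩
    exact disjoint_left.mp hd ((T P).time_subset P (hT.mem_tiles P hP) hyP) hyQ
  rcases hPQ with hPQ | hPQ
  · exact (T Q).scale_lt hC₀ hκ hK (hPQ ▸ hT.mem_tiles P hP) (hT.mem_tiles Q hQ) h
  · have hK0 : K ≠ 0 := by
      rintro rfl
      have := one_le_pow₀ hκ (n := 2)
      simp only [pow_zero] at hK
      linarith
    have := P.i_add
    have := Q.i_add
    rw [← hPQ] at this
    omega

open scoped Classical in
/-- The time intervals of tiles whose frequency intervals contain a fixed one have bounded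
overlap. -/
theorem card_above_le (hT : IsTreeAssignment F S T) (hC₀ : 0 < C₀) (hκ : 1 ≤ κ) {K : ℕ}
    (hK : κ ^ 2 < 2 ^ K) (ω : DyadicInterval) (y : ℝ) :
    ((S.filter fun P => ω.toSet ⊆ P.ω.toSet).filter fun P => y ∈ P.I.toSet).card ≤ K := by
  refine card_le_of_scales _ (fun P hP Q hQ h => ?_) fun P hP Q hQ => ?_
  all_goals
    simp only [Finset.mem_filter] at hP hQ
    have hn := DyadicInterval.toSet_subset_or_subset (hP.1.2 ω.center_mem) (hQ.1.2 ω.center_mem)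
  · have := P.i_add
    have := Q.i_add
    refine Tile.ext_of_freq ?_ hP.2 hQ.2
    rcases hn with hn | hn
    · exact DyadicInterval.eq_of_subset_of_i_eq hn (by omega)
    · exact (DyadicInterval.eq_of_subset_of_i_eq hn (by omega)).symm
  · rcases hn with hn | hn
    · exact hT.scale_lt_of_mem hC₀ hκ hK hP.1.1 hQ.1.1 hP.2 hQ.2 hn
    · have h1 := hT.scale_lt_of_mem hC₀ hκ hK hQ.1.1 hP.1.1 hQ.2 hP.2 hn
      have h2 := DyadicInterval.length_le_iff.mp (Tile.length_le_of_freq_subset hn)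
      -- Used only for 0 < K.
      have h3 := hT.scale_lt_of_mem hC₀ hκ hK hQ.1.1 hQ.1.1 hQ.2 hQ.2 Subset.rfl
      omega

theorem length_le_of_near (hT : IsTreeAssignment F S T) (hC₀ : 0 < C₀) (hκ : 1 ≤ κ)
    {P Q : Tile} (hP : P ∈ S) (hQ : Q ∈ S) (h : Near T P Q) :
    P.I.length ≤ κ ^ 2 * Q.I.length := by
  rcases h.2 with h2 | h2
  · have h3 : P.I.length ≤ Q.I.length := by
      refine Tile.length_le_of_freq_subset ?_
      rw [h2]
    exact h3.trans (le_mul_of_one_le_left Q.I.length_pos.le (one_le_pow₀ hκ))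
  · exact (T Q).length_le hC₀ hκ (h2 ▸ hT.mem_tiles P hP) (hT.mem_tiles Q hQ) h.1

open scoped Classical in
theorem card_near_le (hT : IsTreeAssignment F S T) (hC₀ : 0 < C₀) (hκ : 1 ≤ κ) {K : ℕ}
    (hK : κ ^ 2 < 2 ^ K) {Q : Tile} (hQ : Q ∈ S) (y : ℝ) :
    ((S.filter fun P => Near T P Q).filter fun P => y ∈ P.I.toSet).card ≤ K := by
  have hω : ∀ P ∈ S, Near T P Q → P.ω = Q.ω ∨ P ∈ (T Q).tiles := by
    intro P hP h
    refine h.2.imp_right fun h' => ?_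
    rw [← h']
    exact hT.mem_tiles P hP
  have hi : ∀ P ∈ S, Near T P Q → P.I.i < Q.I.i + K ∧ Q.I.i ≤ P.I.i := by
    intro P hP h
    refine ⟨?_, DyadicInterval.length_le_iff.mp (Tile.length_le_of_freq_subset h.1)⟩
    have h1 := hT.length_le_of_near hC₀ hκ hP hQ h
    have h2 : P.I.length < 2 ^ (Q.I.i + (K : ℤ)) := by
      rw [zpow_add₀ (by norm_num), zpow_natCast, mul_comm]
      exact h1.trans_lt (mul_lt_mul_of_pos_right hK Q.I.length_pos)
    exact (zpow_lt_zpow_iff_right₀ (by norm_num : (1 : ℝ) < 2)).mp h2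
  refine card_le_of_scales _ (fun P hP P' hP' h => ?_) fun P hP P' hP' => ?_
  all_goals
    simp only [Finset.mem_filter] at hP hP'
    have h1 := hi P hP.1.1 hP.1.2
    have h2 := hi P' hP'.1.1 hP'.1.2
  · refine Tile.ext_of_freq ?_ hP.2 hP'.2
    -- At the scale of Q, nesting forces ω_P = ω_Q. At any other scale the tile lies in the tree of
    -- Q, which has one frequency interval per scale.
    by_cases hPi : P.I.i = Q.I.i
    · have := P.i_add
      have := P'.i_add
      have := Q.i_add
      rw [DyadicInterval.eq_of_subset_of_i_eq hP.1.2.1 (by omega),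
        DyadicInterval.eq_of_subset_of_i_eq hP'.1.2.1 (by omega)]
    · have hmem : ∀ R ∈ S, Near T R Q → R.I.i = P.I.i → R ∈ (T Q).tiles := by
        intro R hR hRn hRi
        refine (hω R hR hRn).resolve_left fun h => hPi ?_
        have := R.i_add
        have := Q.i_add
        rw [h] at *
        omega
      exact (T Q).freq_eq P (hmem P hP.1.1 hP.1.2 rfl) P' (hmem P' hP'.1.1 hP'.1.2 h.symm)
        (DyadicInterval.length_eq_iff.mpr h)
  · omega

open scoped Classical in
theorem sum_above_le (hT : IsTreeAssignment F S T) (hC₀ : 0 < C₀) (hκ : 1 ≤ κ) {K : ℕ}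
    (hK : κ ^ 2 < 2 ^ K) (P : Tile) :
    ∑ Q ∈ S with P.ω.toSet ⊆ Q.ω.toSet, Q.I.length * P.I.sqWeight Q.I.center ≤
      4 * Real.pi * K * P.I.length := by
  have h := sum_length_mul_sqWeight_le (S.filter fun Q => P.ω.toSet ⊆ Q.ω.toSet) P.I (K := K)
    le_rfl (fun Q hQ => by
      rw [one_mul]
      exact Tile.length_le_of_freq_subset (Finset.mem_filter.mp hQ).2)
    fun y => hT.card_above_le hC₀ hκ hK P.ω y
  simpa using h

open scoped Classical in
-- Near tiles have comparable lengths, so the roles of P and Q in the weight can be exchanged at the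
-- cost κ^4. The sum over P then has the fixed weight of Q and bounded overlap, which costs (κ²)²
-- more.
theorem sum_near_le (hT : IsTreeAssignment F S T) (hC₀ : 0 < C₀) (hκ : 1 ≤ κ) {K : ℕ}
    (hK : κ ^ 2 < 2 ^ K) {Q : Tile} (hQ : Q ∈ S) :
    ∑ P ∈ S with Near T P Q, P.I.sqWeight Q.I.center ≤ 4 * κ ^ 8 * Real.pi * K := by
  have hκ2 : 1 ≤ κ ^ 2 := one_le_pow₀ hκ
  have h := sum_length_mul_sqWeight_le (S.filter fun P => Near T P Q) Q.I (K := K)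
    hκ2 (fun P hP => by
      have hP := Finset.mem_filter.mp hP
      exact hT.length_le_of_near hC₀ hκ hP.1 hQ hP.2)
    fun y => hT.card_near_le hC₀ hκ hK hQ y
  have h1 : ∀ P ∈ S.filter fun P => Near T P Q, P.I.sqWeight Q.I.center * Q.I.length ≤
      κ ^ 4 * (P.I.length * Q.I.sqWeight P.I.center) := by
    intro P hP
    have hP := Finset.mem_filter.mp hP
    have h2 := hT.length_le_of_near hC₀ hκ hP.1 hQ hP.2
    have h3 := Tile.length_le_of_freq_subset hP.2.1
    have hPl := P.I.length_pos
    have hQl := Q.I.length_pos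
    have h4 : P.I.sqWeight Q.I.center ≤ κ ^ 4 * Q.I.sqWeight P.I.center := by
      have h5 : ((P.I.center - Q.I.center) / Q.I.length) ^ 2 ≤
          κ ^ 4 * ((Q.I.center - P.I.center) / P.I.length) ^ 2 := by
        have h6 : (P.I.length / Q.I.length) ^ 2 ≤ (κ ^ 2) ^ 2 := by
          gcongr
          exact (div_le_iff₀ hQl).mpr h2
        calc ((P.I.center - Q.I.center) / Q.I.length) ^ 2
            = (P.I.length / Q.I.length) ^ 2 * ((Q.I.center - P.I.center) / P.I.length) ^ 2 := by
              field_simp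
              ring
          _ ≤ (κ ^ 2) ^ 2 * ((Q.I.center - P.I.center) / P.I.length) ^ 2 := by gcongr
          _ = _ := by ring
      have h7 : (1 : ℝ) ≤ κ ^ 4 := one_le_pow₀ hκ
      unfold DyadicInterval.sqWeight
      rw [inv_eq_one_div, ← div_eq_mul_inv, div_le_div_iff₀ (by positivity) (by positivity)]
      linarith
    calc P.I.sqWeight Q.I.center * Q.I.length
        ≤ (κ ^ 4 * Q.I.sqWeight P.I.center) * P.I.length := by
          gcongr
          exact mul_nonneg (by positivity) (Q.I.sqWeight_nonneg _)
      _ = _ := by ring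
  refine le_of_mul_le_mul_right ?_ Q.I.length_pos
  calc (∑ P ∈ S with Near T P Q, P.I.sqWeight Q.I.center) * Q.I.length
      ≤ κ ^ 4 * ∑ P ∈ S with Near T P Q, P.I.length * Q.I.sqWeight P.I.center := by
        rw [Finset.sum_mul, Finset.mul_sum]
        exact Finset.sum_le_sum h1
    _ ≤ κ ^ 4 * (4 * (κ ^ 2) ^ 2 * Real.pi * K * Q.I.length) := by gcongr
    _ = _ := by ring

end IsTreeAssignment

end Forest

/-! ### Elementary series -/

theorem sum_inv_add_one_sq_le (s : Finset ℕ) : ∑ n ∈ s, (1 / ((1 : ℝ) + n) ^ 2) ≤ 2 := by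
  have h1 : ∀ N : ℕ, ∑ n ∈ Finset.range N, (1 / ((1 : ℝ) + n) ^ 2) ≤ 2 - 1 / (N : ℝ) := by
    intro N
    induction N with
    | zero => simp
    | succ N ih =>
      rw [Finset.sum_range_succ]
      -- The telescoping step needs N > 0: at N = 0 the term 1/N has the value 0.
      rcases Nat.eq_zero_or_pos N with rfl | hN
      · norm_num
      · have hN' : (0 : ℝ) < N := by exact_mod_cast hN
        have h2 : 1 / ((1 : ℝ) + N) ^ 2 ≤ 1 / N - 1 / (N + 1) := by
          rw [div_sub_div _ _ hN'.ne' (by positivity), div_le_div_iff₀ (by positivity)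
            (by positivity)]
          nlinarith
        push_cast
        linarith
  obtain ⟨N, hN⟩ := s.exists_nat_subset_range
  calc ∑ n ∈ s, (1 / ((1 : ℝ) + n) ^ 2) ≤ ∑ n ∈ Finset.range N, (1 / ((1 : ℝ) + n) ^ 2) :=
        Finset.sum_le_sum_of_subset_of_nonneg hN fun _ _ _ => by positivity
    _ ≤ 2 - 1 / (N : ℝ) := h1 N
    _ ≤ 2 := by
      have : (0 : ℝ) ≤ 1 / (N : ℝ) := by positivity
      linarith

theorem sum_two_zpow_le (s : Finset ℤ) (j : ℤ) (h : ∀ i ∈ s, i ≤ j) :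
    ∑ i ∈ s, (2 : ℝ) ^ i ≤ 2 * 2 ^ j := by
  have h1 : ∑ i ∈ s, (2 : ℝ) ^ i = 2 ^ j * ∑ n ∈ s.image fun i => (j - i).toNat, (1 / 2 : ℝ) ^ n := by
    rw [Finset.sum_image, Finset.mul_sum]
    · refine Finset.sum_congr rfl fun i hi => ?_
      have h2 : i = j - ((j - i).toNat : ℤ) := by have := h i hi; omega
      conv_lhs => rw [h2]
      rw [zpow_sub₀ (by norm_num), zpow_natCast, one_div, inv_pow, div_eq_mul_inv]
    · intro a ha b hb hab
      have := h a ha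
      have := h b hb
      simp only at hab
      omega
  rw [h1, mul_comm]
  gcongr
  have h3 := summable_geometric_two.sum_le_tsum (s.image fun i => (j - i).toNat)
    fun _ _ => by positivity
  rwa [tsum_geometric_two] at h3

/-- The sign ε counts positions from the left end or from the right end; at one scale each position
occurs at most once. -/
theorem sum_shift_inv_sq_le (s : Finset DyadicInterval) (i m : ℤ) (ε : ℤ) (hε : ε = 1 ∨ ε = -1)
    (hi : ∀ I ∈ s, I.i = i) (hm : ∀ I ∈ s, 0 ≤ ε * (I.l - m)) :
    ∑ I ∈ s, 1 / (1 + (ε * (I.l - m) : ℝ)) ^ 2 ≤ 2 := by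
  classical
  refine le_trans (le_of_eq ?_) (sum_inv_add_one_sq_le (s.image fun I => (ε * (I.l - m)).toNat))
  rw [Finset.sum_image]
  · refine Finset.sum_congr rfl fun I hI => ?_
    have h : (((ε * (I.l - m)).toNat : ℤ) : ℝ) = ((ε * (I.l - m) : ℤ) : ℝ) := by
      rw [Int.toNat_of_nonneg (hm I hI)]
    rw [Int.cast_natCast] at h
    rw [h]
    push_cast
    rfl
  · intro I hI J hJ h
    have h1 := hm I hI
    have h2 := hm J hJ
    simp only at h
    have h3 : I.l = J.l := by
      rcases hε with rfl | rfl <;> omega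
    have h4 := (hi I hI).trans (hi J hJ).symm
    cases I
    cases J
    simp_all

/-! ### Carleson packing with a boundary discount -/

namespace DyadicInterval

/-- The distance of `I` from the complement of `J ⊇ I`, relative to the length of `I`. -/
def gap (I J : DyadicInterval) : ℝ :=
  min (I.left - J.left) (J.left + J.length - (I.left + I.length)) / I.length

/-- A bound for `χ_I ^ 2` on the complement of `J`. -/
def edgeWeight (I J : DyadicInterval) : ℝ := 2 / (1 + gap I J) ^ 2

theorem edgeWeight_nonneg (I J : DyadicInterval) : 0 ≤ edgeWeight I J := by
  unfold edgeWeight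
  positivity

theorem gap_nonneg {I J : DyadicInterval} (h : I.toSet ⊆ J.toSet) : 0 ≤ gap I J := by
  have h1 := left_le_of_subset h
  exact div_nonneg (le_min (by linarith) (by linarith)) I.length_pos.le

theorem edgeWeight_anti {I J J' : DyadicInterval} (h : I.toSet ⊆ J.toSet)
    (h' : J.toSet ⊆ J'.toSet) : edgeWeight I J' ≤ edgeWeight I J := by
  have h1 := left_le_of_subset h'
  have h2 := gap_nonneg h
  have h3 : gap I J ≤ gap I J' := by
    exact div_le_div_of_nonneg_right (min_le_min (by linarith) (by linarith)) I.length_pos.le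
  unfold edgeWeight
  gcongr

theorem sqWeight_le_edgeWeight {I J : DyadicInterval} (h : I.toSet ⊆ J.toSet) {x : ℝ}
    (hx : x ∉ J.toSet) : I.sqWeight x ≤ edgeWeight I J := by
  have hI := I.length_pos
  have h0 := gap_nonneg h
  have h1 : gap I J + 1 / 2 ≤ |(x - I.center) / I.length| := by
    rw [abs_div, abs_of_pos hI, le_div_iff₀ hI, add_mul, gap, div_mul_cancel₀ _ hI.ne']
    rw [mem_toSet, not_and_or, not_le, not_lt] at hx
    rcases hx with hx | hx
    · have := min_le_left (I.left - J.left) (J.left + J.length - (I.left + I.length))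
      have := neg_abs_le (x - I.center)
      have hc : I.center = I.left + I.length / 2 := rfl
      linarith
    · have := min_le_right (I.left - J.left) (J.left + J.length - (I.left + I.length))
      have := le_abs_self (x - I.center)
      have hc : I.center = I.left + I.length / 2 := rfl
      linarith
  have h2 : (gap I J + 1 / 2) ^ 2 ≤ ((x - I.center) / I.length) ^ 2 := by
    rw [← sq_abs ((x - I.center) / I.length)]
    gcongr
  unfold sqWeight edgeWeight
  rw [inv_eq_one_div, div_le_div_iff₀ (by positivity) (by positivity)]
  -- With g the gap, 1 + (g + 1/2)² ≥ (1 + g)² / 2, which explains the 2 in `edgeWeight`.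
  nlinarith [sq_nonneg (gap I J)]

theorem edgeWeight_le_add (I J : DyadicInterval) :
    edgeWeight I J ≤ 2 * (1 / (1 + (I.left - J.left) / I.length) ^ 2) +
      2 * (1 / (1 + (J.left + J.length - (I.left + I.length)) / I.length) ^ 2) := by
  unfold edgeWeight gap
  have h1 : 0 ≤ 1 / (1 + (I.left - J.left) / I.length) ^ 2 := by positivity
  have h2 : 0 ≤ 1 / (1 + (J.left + J.length - (I.left + I.length)) / I.length) ^ 2 := by
    positivity
  rcases min_choice (I.left - J.left) (J.left + J.length - (I.left + I.length)) with h3 | h3 <;>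
    rw [h3, div_eq_mul_one_div] <;> linarith

/-- At a fixed scale the gap is the smaller of two integer positions, counted from the two ends of
J, so two copies of ∑ 2/(1+n)² dominate. -/
theorem sum_edgeWeight_scale_le (s : Finset DyadicInterval) (J : DyadicInterval) (i : ℤ)
    (hi : ∀ I ∈ s, I.i = i) (h : ∀ I ∈ s, I.toSet ⊆ J.toSet) :
    ∑ I ∈ s, edgeWeight I J ≤ 8 := by
  rcases s.eq_empty_or_nonempty with rfl | ⟨I₀, hI₀⟩
  · simp
  have hij : i ≤ J.i := hi I₀ hI₀ ▸ length_le_iff.mp (le_of_toSet_subset (h I₀ hI₀))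
  obtain ⟨d, hd⟩ : ∃ d : ℕ, J.i = i + d := ⟨(J.i - i).toNat, by omega⟩
  have h2i : (0 : ℝ) < 2 ^ i := by positivity
  have h2 : (2 : ℝ) ^ J.i = 2 ^ i * 2 ^ d := by
    rw [hd, zpow_add₀ (by norm_num), zpow_natCast]
  have hA : ∀ I ∈ s, (I.left - J.left) / I.length = ((1 : ℤ) : ℝ) * (I.l - ((2 ^ d * J.l : ℤ) : ℝ)) := by
    intro I hI
    simp only [left, length, hi I hI, h2]
    push_cast
    field_simp
  have hB : ∀ I ∈ s, (J.left + J.length - (I.left + I.length)) / I.length =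
      ((-1 : ℤ) : ℝ) * (I.l - ((2 ^ d * (J.l + 1) - 1 : ℤ) : ℝ)) := by
    intro I hI
    simp only [left, length, hi I hI, h2]
    push_cast
    field_simp
    ring
  have hA0 : ∀ I ∈ s, 0 ≤ (1 : ℤ) * (I.l - (2 ^ d * J.l : ℤ)) := by
    intro I hI
    have h3 : 0 ≤ (I.left - J.left) / I.length :=
      div_nonneg (by linarith [(left_le_of_subset (h I hI)).1]) I.length_pos.le
    rw [hA I hI] at h3
    exact_mod_cast h3
  have hB0 : ∀ I ∈ s, 0 ≤ (-1 : ℤ) * (I.l - (2 ^ d * (J.l + 1) - 1 : ℤ)) := by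
    intro I hI
    have h3 : 0 ≤ (J.left + J.length - (I.left + I.length)) / I.length :=
      div_nonneg (by linarith [(left_le_of_subset (h I hI)).2]) I.length_pos.le
    rw [hB I hI] at h3
    exact_mod_cast h3
  calc ∑ I ∈ s, edgeWeight I J
      ≤ ∑ I ∈ s, (2 * (1 / (1 + (I.left - J.left) / I.length) ^ 2) +
        2 * (1 / (1 + (J.left + J.length - (I.left + I.length)) / I.length) ^ 2)) :=
        Finset.sum_le_sum fun I hI => edgeWeight_le_add I J
    _ = 2 * ∑ I ∈ s, 1 / (1 + ((1 : ℤ) : ℝ) * (I.l - ((2 ^ d * J.l : ℤ) : ℝ))) ^ 2 +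
        2 * ∑ I ∈ s, 1 / (1 + ((-1 : ℤ) : ℝ) * (I.l - ((2 ^ d * (J.l + 1) - 1 : ℤ) : ℝ))) ^ 2 := by
        rw [Finset.mul_sum, Finset.mul_sum, ← Finset.sum_add_distrib]
        exact Finset.sum_congr rfl fun I hI => by rw [hA I hI, hB I hI]
    _ ≤ 2 * 2 + 2 * 2 := by
        gcongr
        · exact sum_shift_inv_sq_le s i _ 1 (Or.inl rfl) hi hA0
        · exact sum_shift_inv_sq_le s i _ (-1) (Or.inr rfl) hi hB0
    _ = 8 := by norm_num

/-- The dyadic subintervals of `J`, discounted away from the boundary of `J`, obey a Carleson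
packing bound. -/
theorem sum_edgeWeight_mul_length_le (s : Finset DyadicInterval) (J : DyadicInterval)
    (h : ∀ I ∈ s, I.toSet ⊆ J.toSet) : ∑ I ∈ s, edgeWeight I J * I.length ≤ 16 * J.length := by
  classical
  rw [← Finset.sum_fiberwise_of_maps_to (t := s.image fun I => I.i) (g := fun I => I.i)
    fun I hI => Finset.mem_image_of_mem _ hI]
  -- The discount makes scale i contribute O(2^i) instead of |J|, so the sum over scales is
  -- geometric.
  calc ∑ i ∈ s.image fun I => I.i, ∑ I ∈ s with I.i = i, edgeWeight I J * I.length
      ≤ ∑ i ∈ s.image fun I => I.i, 8 * (2 : ℝ) ^ i := by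
        refine Finset.sum_le_sum fun i _ => ?_
        have h1 : ∑ I ∈ s with I.i = i, edgeWeight I J * I.length =
            (∑ I ∈ s with I.i = i, edgeWeight I J) * 2 ^ i := by
          rw [Finset.sum_mul]
          refine Finset.sum_congr rfl fun I hI => ?_
          rw [length, (Finset.mem_filter.mp hI).2]
        rw [h1]
        gcongr
        exact sum_edgeWeight_scale_le _ J i (fun I hI => (Finset.mem_filter.mp hI).2)
          fun I hI => h I (Finset.mem_filter.mp hI).1
    _ = 8 * ∑ i ∈ s.image fun I => I.i, (2 : ℝ) ^ i := by rw [Finset.mul_sum]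
    _ ≤ 8 * (2 * 2 ^ J.i) := by
        gcongr
        refine sum_two_zpow_le _ _ fun i hi => ?_
        obtain ⟨I, hI, rfl⟩ := Finset.mem_image.mp hi
        exact length_le_iff.mp (le_of_toSet_subset (h I hI))
    _ = 16 * J.length := by rw [length]; ring

end DyadicInterval

/-! ### Packing of forest tiles from the counting function -/

section Forest

variable {C₀ κ : ℝ}

/-- The local form of the bound for the counting function. -/
def CountingBound (F : Set (LacunaryTree C₀ κ)) (M : ℝ) : Prop :=
  ∀ (𝒰 : Finset (LacunaryTree C₀ κ)), (∀ U ∈ 𝒰, U ∈ F) → ∀ J : DyadicInterval,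
    ∑ U ∈ 𝒰, volume.real (U.I.toSet ∩ J.toSet) ≤ M * J.length

theorem countingBound_of_eLpNorm_le {F : Set (LacunaryTree C₀ κ)} {M : ℝ} (hM : 0 ≤ M)
    (h : eLpNorm (countingFunction F) ⊤ volume ≤ ENNReal.ofReal M) : CountingBound F M := by
  intro 𝒰 h𝒰 J
  have hae : ∀ᵐ x, countingFunction F x ≤ ENNReal.ofReal M := by
    have h1 := ae_le_eLpNormEssSup (f := countingFunction F) (μ := volume)
    rw [eLpNorm_exponent_top] at h
    filter_upwards [h1] with x hx
    exact le_trans (by simpa using hx) h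
  have hsum : ∀ x, ∑ U ∈ 𝒰, U.I.toSet.indicator (1 : ℝ → ℝ≥0∞) x ≤ countingFunction F x := by
    intro x
    classical
    have h2 : ∑ U ∈ 𝒰, U.I.toSet.indicator (1 : ℝ → ℝ≥0∞) x =
        ∑ U ∈ 𝒰.subtype (· ∈ F), U.1.I.toSet.indicator (1 : ℝ → ℝ≥0∞) x := by
      rw [Finset.sum_subtype_of_mem (fun U : LacunaryTree C₀ κ =>
        U.I.toSet.indicator (1 : ℝ → ℝ≥0∞) x) h𝒰]
    rw [h2]
    exact ENNReal.sum_le_tsum _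
  have hE : ∑ U ∈ 𝒰, volume (U.I.toSet ∩ J.toSet) ≤ ENNReal.ofReal (M * J.length) := by
    calc ∑ U ∈ 𝒰, volume (U.I.toSet ∩ J.toSet)
        = ∑ U ∈ 𝒰, ∫⁻ x in J.toSet, U.I.toSet.indicator (1 : ℝ → ℝ≥0∞) x := by
          refine Finset.sum_congr rfl fun U _ => ?_
          rw [lintegral_indicator_one U.I.measurableSet_toSet,
            Measure.restrict_apply U.I.measurableSet_toSet]
      _ = ∫⁻ x in J.toSet, ∑ U ∈ 𝒰, U.I.toSet.indicator (1 : ℝ → ℝ≥0∞) x := by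
          rw [lintegral_finsetSum]
          exact fun U _ => measurable_one.indicator U.I.measurableSet_toSet
      _ ≤ ∫⁻ _ in J.toSet, ENNReal.ofReal M := by
          refine lintegral_mono_ae (ae_restrict_of_ae ?_)
          filter_upwards [hae] with x hx
          exact (hsum x).trans hx
      _ = ENNReal.ofReal (M * J.length) := by
          rw [setLIntegral_const, DyadicInterval.volume_toSet, ENNReal.ofReal_mul hM]
  have hfin : ∀ U ∈ 𝒰, volume (U.I.toSet ∩ J.toSet) ≠ ⊤ := fun U _ =>
    ((measure_mono inter_subset_right).trans_lt (by simp [DyadicInterval.volume_toSet])).ne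
  have h3 := ENNReal.toReal_mono ENNReal.ofReal_ne_top hE
  rw [ENNReal.toReal_sum hfin, ENNReal.toReal_ofReal (mul_nonneg hM J.length_pos.le)] at h3
  exact h3

namespace IsTreeAssignment

variable {F : Set (LacunaryTree C₀ κ)} {S : Finset Tile} {T : Tile → LacunaryTree C₀ κ} {M : ℝ}

open scoped Classical in
-- Within one tree a tile is determined by its time interval, so this is packing of dyadic intervals
-- inside I_U ∩ J. That intersection is itself dyadic once D is nonempty, and passing from I_U to it
-- only increases the edge weight.
theorem sum_edgeWeight_tree_le (hT : IsTreeAssignment F S T) (D : Finset Tile) (hD : D ⊆ S)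
    (U : LacunaryTree C₀ κ) (J : DyadicInterval) (hU : ∀ P ∈ D, T P = U)
    (hJ : ∀ P ∈ D, P.I.toSet ⊆ J.toSet) :
    ∑ P ∈ D, P.I.edgeWeight (T P).I * P.I.length ≤ 16 * volume.real (U.I.toSet ∩ J.toSet) := by
  rcases D.eq_empty_or_nonempty with rfl | ⟨P₀, hP₀⟩
  · simp
  have hmem : ∀ P ∈ D, P ∈ U.tiles := fun P hP => hU P hP ▸ hT.mem_tiles P (hD hP)
  have hUI : ∀ P ∈ D, P.I.toSet ⊆ U.I.toSet := fun P hP => U.time_subset P (hmem P hP)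
  obtain ⟨J', hJ'⟩ : ∃ J' : DyadicInterval, J'.toSet = U.I.toSet ∩ J.toSet := by
    rcases DyadicInterval.toSet_subset_or_subset (hUI P₀ hP₀ P₀.I.center_mem)
      (hJ P₀ hP₀ P₀.I.center_mem) with h | h
    · exact ⟨U.I, (inter_eq_left.mpr h).symm⟩
    · exact ⟨J, (inter_eq_right.mpr h).symm⟩
  have hDJ' : ∀ P ∈ D, P.I.toSet ⊆ J'.toSet := fun P hP =>
    hJ' ▸ subset_inter (hUI P hP) (hJ P hP)
  have hinj : Set.InjOn (fun P : Tile => P.I) D := by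
    intro P hP Q hQ h
    simp only at h
    have h1 := P.I.center_mem
    exact U.eq_of_mem (hmem P hP) (hmem Q hQ) (by rw [h]) h1 (h ▸ h1)
  have hvol : volume.real (U.I.toSet ∩ J.toSet) = J'.length := by
    rw [← hJ', measureReal_def, DyadicInterval.volume_toSet,
      ENNReal.toReal_ofReal J'.length_pos.le]
  rw [hvol]
  calc ∑ P ∈ D, P.I.edgeWeight (T P).I * P.I.length
      ≤ ∑ P ∈ D, P.I.edgeWeight J' * P.I.length := by
        refine Finset.sum_le_sum fun P hP => ?_
        have := P.I.length_pos
        gcongr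
        refine DyadicInterval.edgeWeight_anti (hDJ' P hP) ?_
        rw [hJ', hU P hP]
        exact inter_subset_left
    _ = ∑ I ∈ D.image fun P => P.I, I.edgeWeight J' * I.length :=
        (Finset.sum_image (f := fun I => I.edgeWeight J' * I.length) hinj).symm
    _ ≤ 16 * J'.length := by
        refine DyadicInterval.sum_edgeWeight_mul_length_le _ J' fun I hI => ?_
        obtain ⟨P, hP, rfl⟩ := Finset.mem_image.mp hI
        exact hDJ' P hP

open scoped Classical in
-- The packing bounds of the single trees add up, and the counting bound controls ∑ |I_U ∩ J|.
theorem sum_edgeWeight_le (hT : IsTreeAssignment F S T) (hM : CountingBound F M)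
    (D : Finset Tile) (hD : D ⊆ S) (J : DyadicInterval) (hJ : ∀ P ∈ D, P.I.toSet ⊆ J.toSet) :
    ∑ P ∈ D, P.I.edgeWeight (T P).I * P.I.length ≤ 16 * M * J.length := by
  rw [← Finset.sum_fiberwise_of_maps_to (t := D.image T) (g := T)
    fun P hP => Finset.mem_image_of_mem _ hP]
  calc ∑ U ∈ D.image T, ∑ P ∈ D with T P = U, P.I.edgeWeight (T P).I * P.I.length
      ≤ ∑ U ∈ D.image T, 16 * volume.real (U.I.toSet ∩ J.toSet) :=
        Finset.sum_le_sum fun U _ => hT.sum_edgeWeight_tree_le _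
          ((Finset.filter_subset _ _).trans hD) U J (fun P hP => (Finset.mem_filter.mp hP).2)
          fun P hP => hJ P (Finset.mem_filter.mp hP).1
    _ = 16 * ∑ U ∈ D.image T, volume.real (U.I.toSet ∩ J.toSet) := by rw [Finset.mul_sum]
    _ ≤ 16 * (M * J.length) := by
        gcongr
        refine hM _ (fun U hU => ?_) J
        obtain ⟨P, hP, rfl⟩ := Finset.mem_image.mp hU
        exact hT.mem_forest P (hD hP)
    _ = _ := by ring

open scoped Classical in
theorem sum_edgeWeight_mul_sqWeight_le (hT : IsTreeAssignment F S T) (hM : CountingBound F M)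
    (D : Finset Tile) (hD : D ⊆ S) (I : DyadicInterval) :
    ∑ P ∈ D with P.I.length ≤ I.length,
      P.I.edgeWeight (T P).I * P.I.length * I.sqWeight P.I.center ≤
      64 * Real.pi * M * I.length := by
  -- Each tile is charged to the dyadic interval of length |I| containing it. Those containing a
  -- given y coincide, so the packing bound serves as the overlap bound.
  set J : Tile → DyadicInterval := fun P => DyadicInterval.containing I.i P.I.center with hJ
  have hJl : ∀ P, (J P).length = I.length := fun P => rfl
  have h := sum_mul_sqWeight_le (D.filter fun P => P.I.length ≤ I.length) J (fun P => P.I.center)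
    (fun P => P.I.edgeWeight (T P).I * P.I.length) I (μ := 1) (K := 16 * M) le_rfl
    (fun P _ => DyadicInterval.mem_containing _ _)
    (fun P _ => mul_nonneg (DyadicInterval.edgeWeight_nonneg _ _) P.I.length_pos.le)
    (fun P _ => by rw [hJl, one_mul]) fun y => ?_
  · refine h.trans (le_of_eq ?_)
    ring
  · simp only [hJl]
    rw [← Finset.sum_div, div_le_iff₀ I.length_pos]
    refine hT.sum_edgeWeight_le hM _ (((Finset.filter_subset _ _).trans
      (Finset.filter_subset _ _)).trans hD) (DyadicInterval.containing I.i y) fun P hP => ?_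
    simp only [Finset.mem_filter] at hP
    have h1 : J P = DyadicInterval.containing I.i y :=
      DyadicInterval.ext_of_mem rfl hP.2 (DyadicInterval.mem_containing _ _)
    rw [← h1]
    exact DyadicInterval.toSet_subset_of_mem (DyadicInterval.length_le_iff.mp hP.1.2)
      P.I.center_mem (DyadicInterval.mem_containing _ _)

end IsTreeAssignment

end Forest

/-! ### Powers of sums as ordered sums -/

section Ordering

variable {ι : Type*} {ρ x : ι → ℝ}

/-- Induction in increasing order of ρ: a new maximal element sees all earlier ones, and its partial
sum is the whole sum. -/
theorem sq_sum_le_ordered (s : Finset ι) (hx : ∀ i, 0 ≤ x i) :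
    (∑ i ∈ s, x i) ^ 2 ≤ 2 * ∑ i ∈ s, x i * ∑ j ∈ s with ρ j ≤ ρ i, x j := by
  classical
  induction s using Finset.induction_on_max_value ρ with
  | empty => simp
  | insert a s ha hmax ih =>
    have h1 : (insert a s).filter (fun j => ρ j ≤ ρ a) = insert a s :=
      Finset.filter_true_of_mem fun j hj => by
        rcases Finset.mem_insert.mp hj with rfl | hj
        exacts [le_rfl, hmax j hj]
    have h2 : ∑ i ∈ s, x i * ∑ j ∈ s with ρ j ≤ ρ i, x j ≤
        ∑ i ∈ s, x i * ∑ j ∈ insert a s with ρ j ≤ ρ i, x j :=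
      Finset.sum_le_sum fun i _ => mul_le_mul_of_nonneg_left
        (Finset.sum_le_sum_of_subset_of_nonneg
          (Finset.filter_subset_filter _ (Finset.subset_insert a s)) fun j _ _ => hx j) (hx i)
    rw [Finset.sum_insert ha, Finset.sum_insert ha, h1, Finset.sum_insert ha]
    nlinarith [hx a, sq_nonneg (x a)]

theorem cube_sum_le_ordered_aux (s : Finset ι) (hx : ∀ i, 0 ≤ x i) :
    (∑ i ∈ s, x i) ^ 3 ≤ 3 * ∑ i ∈ s, x i * (∑ j ∈ s with ρ j ≤ ρ i, x j) ^ 2 := by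
  classical
  induction s using Finset.induction_on_max_value ρ with
  | empty => simp
  | insert a s ha hmax ih =>
    have h1 : (insert a s).filter (fun j => ρ j ≤ ρ a) = insert a s :=
      Finset.filter_true_of_mem fun j hj => by
        rcases Finset.mem_insert.mp hj with rfl | hj
        exacts [le_rfl, hmax j hj]
    have h2 : ∑ i ∈ s, x i * (∑ j ∈ s with ρ j ≤ ρ i, x j) ^ 2 ≤
        ∑ i ∈ s, x i * (∑ j ∈ insert a s with ρ j ≤ ρ i, x j) ^ 2 :=
      Finset.sum_le_sum fun i _ => mul_le_mul_of_nonneg_left (pow_le_pow_left₀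
        (Finset.sum_nonneg fun j _ => hx j) (Finset.sum_le_sum_of_subset_of_nonneg
          (Finset.filter_subset_filter _ (Finset.subset_insert a s)) fun j _ _ => hx j) 2) (hx i)
    rw [Finset.sum_insert ha, Finset.sum_insert ha, h1, Finset.sum_insert ha]
    have h3 : 0 ≤ ∑ i ∈ s, x i := Finset.sum_nonneg fun j _ => hx j
    have h4 : (x a + ∑ i ∈ s, x i) ^ 3 ≤
        3 * (x a * (x a + ∑ i ∈ s, x i) ^ 2) + (∑ i ∈ s, x i) ^ 3 := by
      have h5 : 0 ≤ 2 * x a ^ 3 + 3 * (x a ^ 2 * ∑ i ∈ s, x i) := by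
        have := hx a
        positivity
      nlinarith [h5]
    linarith

/-- Allows the tiles in a third moment to be taken in decreasing length, at the cost 6 = 3!. -/
theorem cube_sum_le_ordered (s : Finset ι) (hx : ∀ i, 0 ≤ x i) :
    (∑ i ∈ s, x i) ^ 3 ≤
      6 * ∑ i ∈ s, ∑ j ∈ s with ρ j ≤ ρ i, ∑ k ∈ s with ρ k ≤ ρ j, x i * x j * x k := by
  classical
  refine (cube_sum_le_ordered_aux (ρ := ρ) s hx).trans ?_
  have h : ∀ i ∈ s, x i * (∑ j ∈ s with ρ j ≤ ρ i, x j) ^ 2 ≤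
      2 * ∑ j ∈ s with ρ j ≤ ρ i, ∑ k ∈ s with ρ k ≤ ρ j, x i * x j * x k := by
    intro i _
    calc x i * (∑ j ∈ s with ρ j ≤ ρ i, x j) ^ 2
        ≤ x i * (2 * ∑ j ∈ s with ρ j ≤ ρ i, x j *
          ∑ k ∈ (s.filter fun j => ρ j ≤ ρ i) with ρ k ≤ ρ j, x k) :=
          mul_le_mul_of_nonneg_left (sq_sum_le_ordered _ hx) (hx i)
      _ ≤ x i * (2 * ∑ j ∈ s with ρ j ≤ ρ i, x j * ∑ k ∈ s with ρ k ≤ ρ j, x k) := by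
          have h1 : ∀ j ∈ s.filter (fun j => ρ j ≤ ρ i),
              x j * ∑ k ∈ (s.filter fun j => ρ j ≤ ρ i) with ρ k ≤ ρ j, x k ≤
              x j * ∑ k ∈ s with ρ k ≤ ρ j, x k := fun j _ =>
            mul_le_mul_of_nonneg_left (Finset.sum_le_sum_of_subset_of_nonneg
              (Finset.filter_subset_filter _ (Finset.filter_subset _ s)) fun j _ _ => hx j) (hx j)
          have := hx i
          have := Finset.sum_le_sum h1
          gcongr
      _ = _ := by
          simp only [Finset.mul_sum]
          exact Finset.sum_congr rfl fun j _ => Finset.sum_congr rfl fun k _ => by ring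
  calc 3 * ∑ i ∈ s, x i * (∑ j ∈ s with ρ j ≤ ρ i, x j) ^ 2
      ≤ 3 * ∑ i ∈ s, 2 * ∑ j ∈ s with ρ j ≤ ρ i, ∑ k ∈ s with ρ k ≤ ρ j, x i * x j * x k := by
        have := Finset.sum_le_sum h
        gcongr
    _ = _ := by rw [← Finset.mul_sum]; ring

end Ordering

/-! ### Moments of the far interaction -/

section Forest

variable {C₀ κ : ℝ}

open scoped Classical in
/-- The total interaction of `Q` with the tiles of `D` that lie far below it. -/
def farSum (T : Tile → LacunaryTree C₀ κ) (D : Finset Tile) (Q : Tile) : ℝ :=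
  ∑ P ∈ D, if Far T P Q then P.I.sqWeight Q.I.center ^ 3 else 0

theorem farSum_nonneg (T : Tile → LacunaryTree C₀ κ) (D : Finset Tile) (Q : Tile) :
    0 ≤ farSum T D Q :=
  Finset.sum_nonneg fun P _ => by
    split_ifs
    exacts [pow_nonneg (P.I.sqWeight_nonneg _) 3, le_rfl]

namespace IsTreeAssignment

variable {F : Set (LacunaryTree C₀ κ)} {S : Finset Tile} {T : Tile → LacunaryTree C₀ κ} {M : ℝ}

theorem sqWeight_le_edgeWeight_of_far (hT : IsTreeAssignment F S T) {P Q : Tile} (hP : P ∈ S)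
    (hQ : Q ∈ S) (h : Far T P Q) : P.I.sqWeight Q.I.center ≤ P.I.edgeWeight (T P).I :=
  DyadicInterval.sqWeight_le_edgeWeight ((T P).time_subset P (hT.mem_tiles P hP)) fun h1 =>
    disjoint_left.mp (hT.disjoint_of_far hP hQ h) h1 Q.I.center_mem

open scoped Classical in
-- The powers of the weights at c(I_Q) are shared out. P₂ and P₃ each give one to their edge weight;
-- the pairs (P₁, P₂) and (P₂, P₃) give one per member, linking the longer interval to the center of
-- the shorter; one of P₃ remains for the sum over Q. Hence the cube in `farSum`.
theorem triple_far_le (hT : IsTreeAssignment F S T) {P₁ P₂ P₃ Q : Tile}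
    (h₂ : P₂ ∈ S) (h₃ : P₃ ∈ S) (hQ : Q ∈ S) (h21 : P₂.I.length ≤ P₁.I.length)
    (h32 : P₃.I.length ≤ P₂.I.length) :
    Q.I.length * ((if Far T P₁ Q then P₁.I.sqWeight Q.I.center ^ 3 else 0) *
      (if Far T P₂ Q then P₂.I.sqWeight Q.I.center ^ 3 else 0) *
      (if Far T P₃ Q then P₃.I.sqWeight Q.I.center ^ 3 else 0)) ≤
    4 * (P₂.I.edgeWeight (T P₂).I * P₁.I.sqWeight P₂.I.center) *
      (P₃.I.edgeWeight (T P₃).I * P₂.I.sqWeight P₃.I.center) *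
      (if P₃.ω.toSet ⊆ Q.ω.toSet then Q.I.length * P₃.I.sqWeight Q.I.center else 0) := by
  have e2 := P₂.I.edgeWeight_nonneg (T P₂).I
  have e3 := P₃.I.edgeWeight_nonneg (T P₃).I
  have s12 := P₁.I.sqWeight_nonneg P₂.I.center
  have s23 := P₂.I.sqWeight_nonneg P₃.I.center
  have s1 := P₁.I.sqWeight_nonneg Q.I.center
  have s2 := P₂.I.sqWeight_nonneg Q.I.center
  have s3 := P₃.I.sqWeight_nonneg Q.I.center
  have hl := Q.I.length_pos
  have hR : 0 ≤ if P₃.ω.toSet ⊆ Q.ω.toSet then Q.I.length * P₃.I.sqWeight Q.I.center else 0 := by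
    split_ifs <;> positivity
  by_cases hf : Far T P₁ Q ∧ Far T P₂ Q ∧ Far T P₃ Q
  · obtain ⟨f1, f2, f3⟩ := hf
    rw [if_pos f1, if_pos f2, if_pos f3, if_pos f3.1]
    have a1 : P₁.I.sqWeight Q.I.center ^ 3 ≤ P₁.I.sqWeight Q.I.center :=
      pow_le_of_le_one s1 (P₁.I.sqWeight_le_one _) (by norm_num)
    have a2 := hT.sqWeight_le_edgeWeight_of_far h₂ hQ f2
    have a3 := hT.sqWeight_le_edgeWeight_of_far h₃ hQ f3
    have b12 : P₁.I.sqWeight Q.I.center * P₂.I.sqWeight Q.I.center ≤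
        2 * P₁.I.sqWeight P₂.I.center := by
      simpa using DyadicInterval.sqWeight_mul_le le_rfl (by simpa using h21) Q.I.center
    have b23 : P₂.I.sqWeight Q.I.center * P₃.I.sqWeight Q.I.center ≤
        2 * P₂.I.sqWeight P₃.I.center := by
      simpa using DyadicInterval.sqWeight_mul_le le_rfl (by simpa using h32) Q.I.center
    calc Q.I.length * (P₁.I.sqWeight Q.I.center ^ 3 * P₂.I.sqWeight Q.I.center ^ 3 *
          P₃.I.sqWeight Q.I.center ^ 3)
        ≤ Q.I.length * (P₁.I.sqWeight Q.I.center * P₂.I.sqWeight Q.I.center ^ 3 *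
          P₃.I.sqWeight Q.I.center ^ 3) := by gcongr
      _ = P₂.I.sqWeight Q.I.center * (P₁.I.sqWeight Q.I.center * P₂.I.sqWeight Q.I.center) *
          (P₃.I.sqWeight Q.I.center * (P₂.I.sqWeight Q.I.center * P₃.I.sqWeight Q.I.center)) *
          (Q.I.length * P₃.I.sqWeight Q.I.center) := by ring
      _ ≤ P₂.I.edgeWeight (T P₂).I * (2 * P₁.I.sqWeight P₂.I.center) *
          (P₃.I.edgeWeight (T P₃).I * (2 * P₂.I.sqWeight P₃.I.center)) *
          (Q.I.length * P₃.I.sqWeight Q.I.center) := by gcongr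
      _ = _ := by ring
  · have hz : (if Far T P₁ Q then P₁.I.sqWeight Q.I.center ^ 3 else 0) *
        (if Far T P₂ Q then P₂.I.sqWeight Q.I.center ^ 3 else 0) *
        (if Far T P₃ Q then P₃.I.sqWeight Q.I.center ^ 3 else 0) = 0 := by
      split_ifs <;> simp_all
    rw [hz, mul_zero]
    positivity

/-- The third moment of the far interaction. -/
theorem sum_length_mul_farSum_cube_le (hT : IsTreeAssignment F S T) (hM : CountingBound F M)
    (hM0 : 0 ≤ M) (hC₀ : 0 < C₀) (hκ : 1 ≤ κ) {K : ℕ} (hK : κ ^ 2 < 2 ^ K) (D E : Finset Tile)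
    (hD : D ⊆ S) (hE : E ⊆ S) :
    ∑ Q ∈ E, Q.I.length * farSum T D Q ^ 3 ≤
      393216 * Real.pi ^ 3 * K * M ^ 2 * ∑ P ∈ D, P.I.length := by
  classical
  set x : Tile → Tile → ℝ := fun Q P => if Far T P Q then P.I.sqWeight Q.I.center ^ 3 else 0
    with hx
  have hx0 : ∀ Q P, 0 ≤ x Q P := fun Q P => by
    simp only [hx]
    split_ifs
    exacts [pow_nonneg (P.I.sqWeight_nonneg _) 3, le_rfl]
  set e : Tile → ℝ := fun P => P.I.edgeWeight (T P).I with he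
  have he0 : ∀ P, 0 ≤ e P := fun P => DyadicInterval.edgeWeight_nonneg _ _
  have hs0 : ∀ P P' : Tile, 0 ≤ P.I.sqWeight P'.I.center := fun P P' => P.I.sqWeight_nonneg _
  have hQsum : ∀ P₃ : Tile, ∑ Q ∈ E, (if P₃.ω.toSet ⊆ Q.ω.toSet then
      Q.I.length * P₃.I.sqWeight Q.I.center else 0) ≤ 4 * Real.pi * K * P₃.I.length := by
    intro P₃
    rw [← Finset.sum_filter]
    refine le_trans (Finset.sum_le_sum_of_subset_of_nonneg (Finset.filter_subset_filter _ hE)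
      fun Q _ _ => mul_nonneg Q.I.length_pos.le (hs0 _ _)) (hT.sum_above_le hC₀ hκ hK P₃)
  -- Summing over Q first costs |I_{P₃}| by bounded overlap. The sums over P₃ and then P₂ cost one
  -- factor M each by packing, and the sum of |I_{P₁}| is left.
  calc ∑ Q ∈ E, Q.I.length * farSum T D Q ^ 3
      ≤ ∑ Q ∈ E, Q.I.length * (6 * ∑ P₁ ∈ D, ∑ P₂ ∈ D with P₂.I.length ≤ P₁.I.length,
          ∑ P₃ ∈ D with P₃.I.length ≤ P₂.I.length, x Q P₁ * x Q P₂ * x Q P₃) :=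
        Finset.sum_le_sum fun Q _ => mul_le_mul_of_nonneg_left
          (cube_sum_le_ordered D (hx0 Q)) Q.I.length_pos.le
    _ = 6 * ∑ P₁ ∈ D, ∑ P₂ ∈ D with P₂.I.length ≤ P₁.I.length,
          ∑ P₃ ∈ D with P₃.I.length ≤ P₂.I.length,
            ∑ Q ∈ E, Q.I.length * (x Q P₁ * x Q P₂ * x Q P₃) := by
        have h1 : ∀ Q ∈ E, Q.I.length * (6 * ∑ P₁ ∈ D,
            ∑ P₂ ∈ D with P₂.I.length ≤ P₁.I.length,
            ∑ P₃ ∈ D with P₃.I.length ≤ P₂.I.length, x Q P₁ * x Q P₂ * x Q P₃) =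
            6 * ∑ P₁ ∈ D, ∑ P₂ ∈ D with P₂.I.length ≤ P₁.I.length,
            ∑ P₃ ∈ D with P₃.I.length ≤ P₂.I.length,
              Q.I.length * (x Q P₁ * x Q P₂ * x Q P₃) := by
          intro Q _
          rw [mul_left_comm]
          simp only [Finset.mul_sum]
        rw [Finset.sum_congr rfl h1, ← Finset.mul_sum, Finset.sum_comm]
        congr 1
        refine Finset.sum_congr rfl fun P₁ _ => ?_
        rw [Finset.sum_comm]
        refine Finset.sum_congr rfl fun P₂ _ => ?_
        rw [Finset.sum_comm]
    _ ≤ 6 * ∑ P₁ ∈ D, ∑ P₂ ∈ D with P₂.I.length ≤ P₁.I.length,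
          ∑ P₃ ∈ D with P₃.I.length ≤ P₂.I.length,
            4 * (e P₂ * P₁.I.sqWeight P₂.I.center) * (e P₃ * P₂.I.sqWeight P₃.I.center) *
              (4 * Real.pi * K * P₃.I.length) := by
        refine mul_le_mul_of_nonneg_left (Finset.sum_le_sum fun P₁ _ =>
          Finset.sum_le_sum fun P₂ h2 => Finset.sum_le_sum fun P₃ h3 => ?_) (by norm_num)
        rw [Finset.mem_filter] at h2 h3
        refine (Finset.sum_le_sum fun Q hQ => hT.triple_far_le (hD h2.1) (hD h3.1) (hE hQ) h2.2
          h3.2).trans ?_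
        rw [← Finset.mul_sum]
        refine mul_le_mul_of_nonneg_left (hQsum P₃) ?_
        have := he0 P₂
        have := he0 P₃
        have := hs0 P₁ P₂
        have := hs0 P₂ P₃
        positivity
    _ = 6 * ∑ P₁ ∈ D, ∑ P₂ ∈ D with P₂.I.length ≤ P₁.I.length,
          16 * Real.pi * K * (e P₂ * P₁.I.sqWeight P₂.I.center) *
            ∑ P₃ ∈ D with P₃.I.length ≤ P₂.I.length,
              e P₃ * P₃.I.length * P₂.I.sqWeight P₃.I.center := by
        congr 1
        refine Finset.sum_congr rfl fun P₁ _ => Finset.sum_congr rfl fun P₂ _ => ?_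
        rw [Finset.mul_sum]
        exact Finset.sum_congr rfl fun P₃ _ => by ring
    _ ≤ 6 * ∑ P₁ ∈ D, ∑ P₂ ∈ D with P₂.I.length ≤ P₁.I.length,
          16 * Real.pi * K * (e P₂ * P₁.I.sqWeight P₂.I.center) *
            (64 * Real.pi * M * P₂.I.length) := by
        refine mul_le_mul_of_nonneg_left (Finset.sum_le_sum fun P₁ _ =>
          Finset.sum_le_sum fun P₂ _ => mul_le_mul_of_nonneg_left
            (hT.sum_edgeWeight_mul_sqWeight_le hM D hD P₂.I) ?_) (by norm_num)
        have := he0 P₂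
        have := hs0 P₁ P₂
        positivity
    _ = 6 * ∑ P₁ ∈ D, 1024 * Real.pi ^ 2 * K * M *
          ∑ P₂ ∈ D with P₂.I.length ≤ P₁.I.length,
            e P₂ * P₂.I.length * P₁.I.sqWeight P₂.I.center := by
        congr 1
        refine Finset.sum_congr rfl fun P₁ _ => ?_
        rw [Finset.mul_sum]
        exact Finset.sum_congr rfl fun P₂ _ => by ring
    _ ≤ 6 * ∑ P₁ ∈ D, 1024 * Real.pi ^ 2 * K * M * (64 * Real.pi * M * P₁.I.length) := by
        refine mul_le_mul_of_nonneg_left (Finset.sum_le_sum fun P₁ _ => mul_le_mul_of_nonneg_left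
            (hT.sum_edgeWeight_mul_sqWeight_le hM D hD P₁.I) (by positivity)) (by norm_num)
    _ = _ := by
        rw [Finset.mul_sum, Finset.mul_sum]
        exact Finset.sum_congr rfl fun P₁ _ => by ring

/-- V ≤ t + V³/t² converts the third moment into a first moment with a free parameter, chosen later
from the level difference. -/
theorem sum_length_mul_farSum_le (hT : IsTreeAssignment F S T) (hM : CountingBound F M)
    (hM0 : 0 ≤ M) (hC₀ : 0 < C₀) (hκ : 1 ≤ κ) {K : ℕ} (hK : κ ^ 2 < 2 ^ K) (D E : Finset Tile)
    (hD : D ⊆ S) (hE : E ⊆ S) {t : ℝ} (ht : 0 < t) :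
    ∑ Q ∈ E, Q.I.length * farSum T D Q ≤ t * ∑ Q ∈ E, Q.I.length +
      393216 * Real.pi ^ 3 * K * M ^ 2 / t ^ 2 * ∑ P ∈ D, P.I.length := by
  have h1 := hT.sum_length_mul_farSum_cube_le hM hM0 hC₀ hκ hK D E hD hE
  have h2 : ∀ V : ℝ, 0 ≤ V → V ≤ t + V ^ 3 / t ^ 2 := by
    intro V hV
    rcases le_total V t with h | h
    · have : 0 ≤ V ^ 3 / t ^ 2 := by positivity
      linarith
    · have : V ≤ V ^ 3 / t ^ 2 := by
        rw [le_div_iff₀ (by positivity), pow_succ' V 2]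
        gcongr
      linarith
  calc ∑ Q ∈ E, Q.I.length * farSum T D Q
      ≤ ∑ Q ∈ E, Q.I.length * (t + farSum T D Q ^ 3 / t ^ 2) :=
        Finset.sum_le_sum fun Q _ => mul_le_mul_of_nonneg_left
          (h2 _ (farSum_nonneg T D Q)) Q.I.length_pos.le
    _ = t * ∑ Q ∈ E, Q.I.length + (∑ Q ∈ E, Q.I.length * farSum T D Q ^ 3) / t ^ 2 := by
        rw [Finset.mul_sum, Finset.sum_div, ← Finset.sum_add_distrib]
        exact Finset.sum_congr rfl fun Q _ => by ring
    _ ≤ t * ∑ Q ∈ E, Q.I.length +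
        (393216 * Real.pi ^ 3 * K * M ^ 2 * ∑ P ∈ D, P.I.length) / t ^ 2 := by gcongr
    _ = _ := by ring

end IsTreeAssignment

/-! ### Summation over separated levels -/

theorem sum_two_zpow_sub_le (s : Finset ℤ) (f : ℤ → ℤ) (hf : Set.InjOn f s) {L : ℕ}
    (h : ∀ m ∈ s, f m ≤ -L) {W : ℝ} (hW : W ≤ 2 ^ L) :
    W * ∑ m ∈ s, (2 : ℝ) ^ f m ≤ 2 := by
  have h1 : ∑ m ∈ s, (2 : ℝ) ^ f m ≤ 2 * 2 ^ (-(L : ℤ)) := by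
    rw [← Finset.sum_image (f := fun m => (2 : ℝ) ^ m) hf]
    refine sum_two_zpow_le _ _ fun i hi => ?_
    obtain ⟨m, hm, rfl⟩ := Finset.mem_image.mp hi
    exact h m hm
  calc W * ∑ m ∈ s, (2 : ℝ) ^ f m ≤ 2 ^ L * (2 * 2 ^ (-(L : ℤ))) := by gcongr
    _ = 2 := by
      rw [zpow_neg, zpow_natCast]
      field_simp

namespace IsTreeAssignment

variable {F : Set (LacunaryTree C₀ κ)} {S : Finset Tile} {T : Tile → LacunaryTree C₀ κ} {M : ℝ}

open scoped Classical in
/-- Far interactions between levels that are separated by a multiple of `log M` are summable. -/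
theorem sum_far_levels_le (hT : IsTreeAssignment F S T) (hM : CountingBound F M)
    (hM0 : 0 ≤ M) (hC₀ : 0 < C₀) (hκ : 1 ≤ κ) {K : ℕ} (hK : κ ^ 2 < 2 ^ K) (D : Finset Tile)
    (hD : D ⊆ S) (n : Tile → ℤ) {L : ℕ} (hL : M ^ 2 ≤ 2 ^ L)
    (hsep : ∀ P ∈ D, ∀ Q ∈ D, n P < n Q → n P + L ≤ n Q) :
    ∑ Q ∈ D, ∑ P ∈ D, (if n P < n Q ∧ Far T P Q then
      (8 : ℝ) ^ n P * 8 ^ n Q * (Q.I.length * P.I.sqWeight Q.I.center ^ 3) else 0) ≤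
    (2 + 786432 * Real.pi ^ 3 * K) * ∑ P ∈ D, (64 : ℝ) ^ n P * P.I.length := by
  set N := D.image n with hN
  set X : ℝ := 393216 * Real.pi ^ 3 * K with hX
  have hX0 : 0 ≤ X := by positivity
  set Y : ℤ → ℝ := fun m => ∑ P ∈ D with n P = m, P.I.length with hY
  have hY0 : ∀ m, 0 ≤ Y m := fun m => Finset.sum_nonneg fun P _ => P.I.length_pos.le
  have hmem : ∀ P ∈ D, n P ∈ N := fun P hP => Finset.mem_image_of_mem n hP
  have hNsep : ∀ m ∈ N, ∀ m' ∈ N, m < m' → m + L ≤ m' := by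
    intro m hm m' hm' h
    obtain ⟨P, hP, rfl⟩ := Finset.mem_image.mp hm
    obtain ⟨Q, hQ, rfl⟩ := Finset.mem_image.mp hm'
    exact hsep P hP Q hQ h
  have hE : ∑ m ∈ N, (64 : ℝ) ^ m * Y m = ∑ P ∈ D, (64 : ℝ) ^ n P * P.I.length := by
    rw [← Finset.sum_fiberwise_of_maps_to hmem]
    refine Finset.sum_congr rfl fun m _ => ?_
    rw [hY, Finset.mul_sum]
    refine Finset.sum_congr rfl fun P hP => ?_
    rw [(Finset.mem_filter.mp hP).2]
  have hinner : ∀ Q ∈ D, ∑ P ∈ D, (if n P < n Q ∧ Far T P Q then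
      (8 : ℝ) ^ n P * 8 ^ n Q * (Q.I.length * P.I.sqWeight Q.I.center ^ 3) else 0) =
      ∑ m ∈ N with m < n Q, (8 : ℝ) ^ m * 8 ^ n Q *
        (Q.I.length * farSum T (D.filter fun P => n P = m) Q) := by
    intro Q _
    rw [← Finset.sum_fiberwise_of_maps_to hmem, Finset.sum_filter]
    refine Finset.sum_congr rfl fun m _ => ?_
    split_ifs with h
    · rw [farSum, Finset.mul_sum, Finset.mul_sum]
      refine Finset.sum_congr rfl fun P hP => ?_
      rw [(Finset.mem_filter.mp hP).2]
      by_cases hf : Far T P Q <;> simp [h, hf]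
    · refine Finset.sum_eq_zero fun P hP => ?_
      rw [(Finset.mem_filter.mp hP).2, if_neg fun h' => h h'.1]
  have hpair : ∀ m' : ℤ, ∀ m : ℤ, (8 : ℝ) ^ m * 8 ^ m' *
      ∑ Q ∈ D with n Q = m', Q.I.length * farSum T (D.filter fun P => n P = m) Q ≤
      64 ^ m' * Y m' * 2 ^ (m - m') + X * M ^ 2 * (64 ^ m * Y m * 2 ^ (m - m')) := by
    intro m' m
    -- The choice t = 4^(m'-m) balances the terms: 8^(m+m') t = 64^m' 2^(m-m') and 8^(m+m') / t² =
    -- 64^m 2^(m-m').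
    have h1 := hT.sum_length_mul_farSum_le hM hM0 hC₀ hκ hK (D.filter fun P => n P = m)
      (D.filter fun Q => n Q = m') ((Finset.filter_subset _ _).trans hD)
      ((Finset.filter_subset _ _).trans hD) (t := 4 ^ (m' - m)) (by positivity)
    have e8 : ∀ k : ℤ, (8 : ℝ) ^ k = (2 ^ k) ^ 3 := fun k => by
      rw [← zpow_natCast ((2 : ℝ) ^ k), zpow_comm, zpow_natCast]; norm_num
    have e4 : ∀ k : ℤ, (4 : ℝ) ^ k = (2 ^ k) ^ 2 := fun k => by
      rw [← zpow_natCast ((2 : ℝ) ^ k), zpow_comm, zpow_natCast]; norm_num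
    have e64 : ∀ k : ℤ, (64 : ℝ) ^ k = (2 ^ k) ^ 6 := fun k => by
      rw [← zpow_natCast ((2 : ℝ) ^ k), zpow_comm, zpow_natCast]; norm_num
    have hm : (0 : ℝ) < 2 ^ m := by positivity
    have hm' : (0 : ℝ) < 2 ^ m' := by positivity
    calc (8 : ℝ) ^ m * 8 ^ m' *
          ∑ Q ∈ D with n Q = m', Q.I.length * farSum T (D.filter fun P => n P = m) Q
        ≤ (8 : ℝ) ^ m * 8 ^ m' * (4 ^ (m' - m) * Y m' +
          X * M ^ 2 / (4 ^ (m' - m)) ^ 2 * Y m) := by gcongr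
      _ = _ := by
        rw [e4, e8, e8, e64, e64, zpow_sub₀ (by norm_num), zpow_sub₀ (by norm_num)]
        field_simp
  have hout : ∑ Q ∈ D, ∑ m ∈ N with m < n Q, (8 : ℝ) ^ m * 8 ^ n Q *
        (Q.I.length * farSum T (D.filter fun P => n P = m) Q) =
      ∑ m' ∈ N, ∑ m ∈ N with m < m', (8 : ℝ) ^ m * 8 ^ m' *
        ∑ Q ∈ D with n Q = m', Q.I.length * farSum T (D.filter fun P => n P = m) Q := by
    rw [← Finset.sum_fiberwise_of_maps_to hmem]
    refine Finset.sum_congr rfl fun m' _ => ?_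
    simp only [Finset.mul_sum]
    rw [Finset.sum_comm' (t' := N.filter fun m => m < m') (s' := fun _ => D.filter fun Q => n Q = m')]
    · refine Finset.sum_congr rfl fun m _ => Finset.sum_congr rfl fun Q hQ => ?_
      rw [(Finset.mem_filter.mp hQ).2]
    · intro Q m
      simp only [Finset.mem_filter]
      constructor
      · rintro ⟨⟨h1, rfl⟩, h2, h3⟩
        exact ⟨⟨h1, rfl⟩, h2, h3⟩
      · rintro ⟨⟨h1, rfl⟩, h2, h3⟩
        exact ⟨⟨h1, rfl⟩, h2, h3⟩
  rw [Finset.sum_congr rfl hinner, hout]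
  calc ∑ m' ∈ N, ∑ m ∈ N with m < m', (8 : ℝ) ^ m * 8 ^ m' *
        ∑ Q ∈ D with n Q = m', Q.I.length * farSum T (D.filter fun P => n P = m) Q
      ≤ ∑ m' ∈ N, ∑ m ∈ N with m < m', (64 ^ m' * Y m' * 2 ^ (m - m') +
          X * M ^ 2 * (64 ^ m * Y m * 2 ^ (m - m'))) :=
        Finset.sum_le_sum fun m' _ => Finset.sum_le_sum fun m _ => hpair m' m
    -- The first term is summed over the lower level m and needs no gain in M. The second is summed
    -- over the upper level m', where the separation L absorbs M².
    _ = ∑ m' ∈ N, 64 ^ m' * Y m' * (1 * ∑ m ∈ N with m < m', (2 : ℝ) ^ (m - m')) +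
        X * ∑ m ∈ N, 64 ^ m * Y m * (M ^ 2 * ∑ m' ∈ N with m < m', (2 : ℝ) ^ (m - m')) := by
        simp only [Finset.sum_add_distrib, Finset.mul_sum, one_mul]
        congr 1
        rw [Finset.sum_comm' (t' := N) (s' := fun m => N.filter fun m' => m < m')]
        · exact Finset.sum_congr rfl fun m _ => Finset.sum_congr rfl fun m' _ => by ring
        · intro m' m
          simp only [Finset.mem_filter]
          tauto
    _ ≤ ∑ m' ∈ N, 64 ^ m' * Y m' * 2 + X * ∑ m ∈ N, 64 ^ m * Y m * 2 := by
        gcongr with m' hm' m hm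
        · exact mul_nonneg (by positivity) (hY0 m')
        · refine sum_two_zpow_sub_le _ (fun m => m - m') (fun a _ b _ h => by simpa using h)
            (L := L) (fun m hm => ?_) (one_le_pow₀ one_le_two)
          rw [Finset.mem_filter] at hm
          have := hNsep m hm.1 m' hm' hm.2
          omega
        · exact mul_nonneg (by positivity) (hY0 m)
        · refine sum_two_zpow_sub_le _ (fun m' => m - m') (fun a _ b _ h => by simpa using h)
            (L := L) (fun m' hm' => ?_) hL
          rw [Finset.mem_filter] at hm'
          have := hNsep m hm m' hm'.1 hm'.2
          omega
    _ = _ := by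
        rw [← Finset.sum_mul, hE, hX]
        ring

open scoped Classical in
-- Three cases. If n Q ≤ n P then z_Q ≤ 8 z_P and Q is summed for fixed P. If n P < n Q and the pair
-- is near, then z_P ≤ z_Q and P is summed for fixed Q. The far pairs with n P < n Q go to
-- `sum_far_levels_le`, where rounding both coefficients to powers of 8 costs 64.
theorem sum_nested_le (hT : IsTreeAssignment F S T) (hM : CountingBound F M)
    (hM0 : 0 ≤ M) (hC₀ : 0 < C₀) (hκ : 1 ≤ κ) {K : ℕ} (hK : κ ^ 2 < 2 ^ K) (D : Finset Tile)
    (hD : D ⊆ S) (n : Tile → ℤ) {L : ℕ} (hL : M ^ 2 ≤ 2 ^ L)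
    (hsep : ∀ P ∈ D, ∀ Q ∈ D, n P < n Q → n P + L ≤ n Q) (z : Tile → ℝ)
    (hz1 : ∀ P ∈ D, 8 ^ n P ≤ z P) (hz2 : ∀ P ∈ D, z P ≤ 8 ^ (n P + 1)) :
    ∑ Q ∈ D, ∑ P ∈ D, (if P.ω.toSet ⊆ Q.ω.toSet then
      z P * z Q * (Q.I.length * P.I.sqWeight Q.I.center ^ 3) else 0) ≤
    (32 * Real.pi * K + 4 * κ ^ 8 * Real.pi * K + 64 * (2 + 786432 * Real.pi ^ 3 * K)) *
      ∑ P ∈ D, z P ^ 2 * P.I.length := by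
  have hpos : ∀ P ∈ D, 0 < z P := fun P hP => lt_of_lt_of_le (by positivity) (hz1 P hP)
  have hpt : ∀ Q ∈ D, ∀ P ∈ D, (if P.ω.toSet ⊆ Q.ω.toSet then
      z P * z Q * (Q.I.length * P.I.sqWeight Q.I.center ^ 3) else 0) ≤
      (if P.ω.toSet ⊆ Q.ω.toSet then
        8 * z P ^ 2 * (Q.I.length * P.I.sqWeight Q.I.center) else 0) +
      (if Near T P Q then z Q ^ 2 * Q.I.length * P.I.sqWeight Q.I.center else 0) +
      64 * (if n P < n Q ∧ Far T P Q then
        (8 : ℝ) ^ n P * 8 ^ n Q * (Q.I.length * P.I.sqWeight Q.I.center ^ 3) else 0) := by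
    intro Q hQ P hP
    have s0 := P.I.sqWeight_nonneg Q.I.center
    have s3 : P.I.sqWeight Q.I.center ^ 3 ≤ P.I.sqWeight Q.I.center :=
      pow_le_of_le_one s0 (P.I.sqWeight_le_one _) (by norm_num)
    have hl := Q.I.length_pos
    have zP := hpos P hP
    have zQ := hpos Q hQ
    have hA : (0 : ℝ) ≤ if P.ω.toSet ⊆ Q.ω.toSet then
        8 * z P ^ 2 * (Q.I.length * P.I.sqWeight Q.I.center) else 0 := by
      split_ifs <;> positivity
    have hB : (0 : ℝ) ≤ if Near T P Q then z Q ^ 2 * Q.I.length * P.I.sqWeight Q.I.center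
        else 0 := by
      split_ifs <;> positivity
    have hC : (0 : ℝ) ≤ 64 * (if n P < n Q ∧ Far T P Q then
        (8 : ℝ) ^ n P * 8 ^ n Q * (Q.I.length * P.I.sqWeight Q.I.center ^ 3) else 0) := by
      split_ifs <;> positivity
    by_cases h : P.ω.toSet ⊆ Q.ω.toSet
    · rw [if_pos h]
      have h2P := hz2 P hP
      have h2Q := hz2 Q hQ
      rw [zpow_add₀ (by norm_num), zpow_one] at h2P h2Q
      rcases le_or_gt (n Q) (n P) with hn | hn
      · have h1 : z Q ≤ 8 * z P := by
          have h3 : (8 : ℝ) ^ n Q ≤ 8 ^ n P := zpow_le_zpow_right₀ (by norm_num) hn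
          linarith [hz1 P hP]
        have h4 : z P * z Q * (Q.I.length * P.I.sqWeight Q.I.center ^ 3) ≤
            8 * z P ^ 2 * (Q.I.length * P.I.sqWeight Q.I.center) :=
          calc z P * z Q * (Q.I.length * P.I.sqWeight Q.I.center ^ 3)
              ≤ z P * (8 * z P) * (Q.I.length * P.I.sqWeight Q.I.center) := by gcongr
            _ = _ := by ring
        rw [if_pos h] at hA ⊢
        linarith
      · by_cases hf : P.ω = Q.ω ∨ T P = T Q
        · have h1 : z P ≤ z Q := by
            have h3 : (8 : ℝ) ^ (n P + 1) ≤ 8 ^ n Q := zpow_le_zpow_right₀ (by norm_num) hn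
            linarith [hz1 Q hQ, hz2 P hP]
          have h4 : z P * z Q * (Q.I.length * P.I.sqWeight Q.I.center ^ 3) ≤
              z Q ^ 2 * Q.I.length * P.I.sqWeight Q.I.center :=
            calc z P * z Q * (Q.I.length * P.I.sqWeight Q.I.center ^ 3)
                ≤ z Q * z Q * (Q.I.length * P.I.sqWeight Q.I.center) := by gcongr
              _ = _ := by ring
          rw [if_pos (show Near T P Q from ⟨h, hf⟩)] at hB ⊢
          linarith
        · have h4 : z P * z Q * (Q.I.length * P.I.sqWeight Q.I.center ^ 3) ≤
              64 * ((8 : ℝ) ^ n P * 8 ^ n Q * (Q.I.length * P.I.sqWeight Q.I.center ^ 3)) :=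
            calc z P * z Q * (Q.I.length * P.I.sqWeight Q.I.center ^ 3)
                ≤ (8 ^ n P * 8) * (8 ^ n Q * 8) *
                  (Q.I.length * P.I.sqWeight Q.I.center ^ 3) := by gcongr
              _ = _ := by ring
          rw [if_pos (show n P < n Q ∧ Far T P Q from ⟨hn, h, hf⟩)] at hC ⊢
          linarith
    · rw [if_neg h]
      exact add_nonneg (add_nonneg hA hB) hC
  have hI : ∑ Q ∈ D, ∑ P ∈ D, (if P.ω.toSet ⊆ Q.ω.toSet then
      8 * z P ^ 2 * (Q.I.length * P.I.sqWeight Q.I.center) else 0) ≤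
      32 * Real.pi * K * ∑ P ∈ D, z P ^ 2 * P.I.length := by
    rw [Finset.sum_comm, Finset.mul_sum]
    refine Finset.sum_le_sum fun P _ => ?_
    rw [← Finset.sum_filter, ← Finset.mul_sum]
    calc 8 * z P ^ 2 * ∑ Q ∈ D with P.ω.toSet ⊆ Q.ω.toSet, Q.I.length * P.I.sqWeight Q.I.center
        ≤ 8 * z P ^ 2 * (4 * Real.pi * K * P.I.length) := by
          gcongr
          exact le_trans (Finset.sum_le_sum_of_subset_of_nonneg (Finset.filter_subset_filter _ hD)
            fun Q _ _ => mul_nonneg Q.I.length_pos.le (P.I.sqWeight_nonneg _))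
            (hT.sum_above_le hC₀ hκ hK P)
      _ = _ := by ring
  have hII : ∑ Q ∈ D, ∑ P ∈ D, (if Near T P Q then
      z Q ^ 2 * Q.I.length * P.I.sqWeight Q.I.center else 0) ≤
      4 * κ ^ 8 * Real.pi * K * ∑ P ∈ D, z P ^ 2 * P.I.length := by
    rw [Finset.mul_sum]
    refine Finset.sum_le_sum fun Q hQ => ?_
    have hl := Q.I.length_pos
    rw [← Finset.sum_filter, ← Finset.mul_sum]
    calc z Q ^ 2 * Q.I.length * ∑ P ∈ D with Near T P Q, P.I.sqWeight Q.I.center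
        ≤ z Q ^ 2 * Q.I.length * (4 * κ ^ 8 * Real.pi * K) := by
          gcongr
          exact le_trans (Finset.sum_le_sum_of_subset_of_nonneg (Finset.filter_subset_filter _ hD)
            fun P _ _ => P.I.sqWeight_nonneg _) (hT.sum_near_le hC₀ hκ hK (hD hQ))
      _ = _ := by ring
  have hIII := hT.sum_far_levels_le hM hM0 hC₀ hκ hK D hD n hL hsep
  have hE : ∑ P ∈ D, (64 : ℝ) ^ n P * P.I.length ≤ ∑ P ∈ D, z P ^ 2 * P.I.length := by
    refine Finset.sum_le_sum fun P hP => ?_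
    have hl := P.I.length_pos
    have h1 : (64 : ℝ) ^ n P = (8 ^ n P) ^ 2 := by
      rw [← zpow_natCast ((8 : ℝ) ^ n P), zpow_comm, zpow_natCast]
      norm_num
    rw [h1]
    have := hz1 P hP
    gcongr
  calc _ ≤ ∑ Q ∈ D, ∑ P ∈ D, ((if P.ω.toSet ⊆ Q.ω.toSet then
        8 * z P ^ 2 * (Q.I.length * P.I.sqWeight Q.I.center) else 0) +
      (if Near T P Q then z Q ^ 2 * Q.I.length * P.I.sqWeight Q.I.center else 0) +
      64 * (if n P < n Q ∧ Far T P Q then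
        (8 : ℝ) ^ n P * 8 ^ n Q * (Q.I.length * P.I.sqWeight Q.I.center ^ 3) else 0)) :=
        Finset.sum_le_sum fun Q hQ => Finset.sum_le_sum fun P hP => hpt Q hQ P hP
    _ = ∑ Q ∈ D, ∑ P ∈ D, (if P.ω.toSet ⊆ Q.ω.toSet then
        8 * z P ^ 2 * (Q.I.length * P.I.sqWeight Q.I.center) else 0) +
      ∑ Q ∈ D, ∑ P ∈ D, (if Near T P Q then
        z Q ^ 2 * Q.I.length * P.I.sqWeight Q.I.center else 0) +
      64 * ∑ Q ∈ D, ∑ P ∈ D, (if n P < n Q ∧ Far T P Q then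
        (8 : ℝ) ^ n P * 8 ^ n Q * (Q.I.length * P.I.sqWeight Q.I.center ^ 3) else 0) := by
        simp only [Finset.sum_add_distrib, Finset.mul_sum]
    _ ≤ 32 * Real.pi * K * ∑ P ∈ D, z P ^ 2 * P.I.length +
        4 * κ ^ 8 * Real.pi * K * ∑ P ∈ D, z P ^ 2 * P.I.length +
        64 * ((2 + 786432 * Real.pi ^ 3 * K) * ∑ P ∈ D, z P ^ 2 * P.I.length) := by
        refine add_le_add (add_le_add hI hII) (mul_le_mul_of_nonneg_left (hIII.trans ?_)
          (by norm_num))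
        gcongr
    _ = _ := by ring

end IsTreeAssignment

end Forest

/-! ### Bessel inequality in a Hilbert space -/

section Forest

variable {C₀ κ : ℝ} {H : Type*} [NormedAddCommGroup H] [InnerProductSpace ℂ H]

/-- The inner products of the family `v` obey the bounds for wave packets. -/
structure AlmostOrthogonal (S : Finset Tile) (v : Tile → H) (A : ℝ) : Prop where
  nonneg : 0 ≤ A
  inner_eq_zero : ∀ P ∈ S, ∀ Q ∈ S, ¬ P.ω.toSet ⊆ Q.ω.toSet → ¬ Q.ω.toSet ⊆ P.ω.toSet →
    inner ℂ (v P) (v Q) = 0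
  norm_inner_le : ∀ P ∈ S, ∀ Q ∈ S, P.ω.toSet ⊆ Q.ω.toSet →
    √P.I.length * √Q.I.length * ‖inner ℂ (v P) (v Q)‖ ≤
      A * (Q.I.length * P.I.sqWeight Q.I.center ^ 3)

/-- The constant in the Bessel inequality for separated levels. -/
def levelConstant (κ A : ℝ) (K : ℕ) : ℝ :=
  2 * A * (32 * Real.pi * K + 4 * κ ^ 8 * Real.pi * K + 64 * (2 + 786432 * Real.pi ^ 3 * K))

theorem levelConstant_nonneg (κ : ℝ) {A : ℝ} (hA : 0 ≤ A) (K : ℕ) : 0 ≤ levelConstant κ A K := by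
  unfold levelConstant
  positivity

namespace IsTreeAssignment

variable {F : Set (LacunaryTree C₀ κ)} {S : Finset Tile} {T : Tile → LacunaryTree C₀ κ} {M : ℝ}

theorem norm_sq_sum_levels_le (hT : IsTreeAssignment F S T) (hM : CountingBound F M)
    (hM0 : 0 ≤ M) (hC₀ : 0 < C₀) (hκ : 1 ≤ κ) {K : ℕ} (hK : κ ^ 2 < 2 ^ K) {v : Tile → H} {A : ℝ}
    (hv : AlmostOrthogonal S v A) (D : Finset Tile)
    (hD : D ⊆ S) (n : Tile → ℤ) {L : ℕ} (hL : M ^ 2 ≤ 2 ^ L)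
    (hsep : ∀ P ∈ D, ∀ Q ∈ D, n P < n Q → n P + L ≤ n Q) (a : Tile → ℂ)
    (hz1 : ∀ P ∈ D, 8 ^ n P ≤ ‖a P‖ / √P.I.length)
    (hz2 : ∀ P ∈ D, ‖a P‖ / √P.I.length ≤ 8 ^ (n P + 1)) :
    ‖∑ P ∈ D, a P • v P‖ ^ 2 ≤ levelConstant κ A K * ∑ P ∈ D, ‖a P‖ ^ 2 := by
  classical
  set z : Tile → ℝ := fun P => ‖a P‖ / √P.I.length with hz
  have hsq : ∀ P : Tile, 0 < √P.I.length := fun P => Real.sqrt_pos.mpr P.I.length_pos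
  have haz : ∀ P, ‖a P‖ = z P * √P.I.length := fun P => (div_mul_cancel₀ _ (hsq P).ne').symm
  set R : Tile → Tile → ℝ := fun P Q => if P.ω.toSet ⊆ Q.ω.toSet then
      z P * z Q * (Q.I.length * P.I.sqWeight Q.I.center ^ 3) else 0 with hR
  have hz0 : ∀ P, 0 ≤ z P := fun P => by positivity
  have hR0 : ∀ P Q, 0 ≤ R P Q := fun P Q => by
    have := hz0 P
    have := hz0 Q
    have := P.I.sqWeight_nonneg Q.I.center
    have := Q.I.length_pos
    simp only [hR]
    split_ifs <;> positivity
  have hle : ∀ P ∈ D, ∀ Q ∈ D, P.ω.toSet ⊆ Q.ω.toSet →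
      ‖a P‖ * ‖a Q‖ * ‖inner ℂ (v P) (v Q)‖ ≤ A * R P Q := by
    intro P hP Q hQ h
    have h1 := hv.norm_inner_le P (hD hP) Q (hD hQ) h
    have := hz0 P
    have := hz0 Q
    simp only [hR, if_pos h]
    rw [haz P, haz Q]
    calc z P * √P.I.length * (z Q * √Q.I.length) * ‖inner ℂ (v P) (v Q)‖
        = z P * z Q * (√P.I.length * √Q.I.length * ‖inner ℂ (v P) (v Q)‖) := by ring
      _ ≤ z P * z Q * (A * (Q.I.length * P.I.sqWeight Q.I.center ^ 3)) := by gcongr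
      _ = _ := by ring
  -- Each pair is charged to whichever orientation is nested; keeping both orientations produces the
  -- factor 2 in `levelConstant`.
  have hpair : ∀ P ∈ D, ∀ Q ∈ D, ‖a P‖ * ‖a Q‖ * ‖inner ℂ (v P) (v Q)‖ ≤
      A * (R P Q + R Q P) := by
    intro P hP Q hQ
    have hPQ := mul_nonneg hv.nonneg (hR0 P Q)
    have hQP := mul_nonneg hv.nonneg (hR0 Q P)
    rw [mul_add]
    by_cases h1 : P.ω.toSet ⊆ Q.ω.toSet
    · linarith [hle P hP Q hQ h1]
    by_cases h2 : Q.ω.toSet ⊆ P.ω.toSet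
    · have h3 := hle Q hQ P hP h2
      rw [norm_inner_symm, mul_comm ‖a Q‖] at h3
      linarith
    · rw [hv.inner_eq_zero P (hD hP) Q (hD hQ) h1 h2, norm_zero, mul_zero]
      linarith
  have hmain := hT.sum_nested_le hM hM0 hC₀ hκ hK D hD n hL hsep z hz1 hz2
  have hE : ∑ P ∈ D, z P ^ 2 * P.I.length = ∑ P ∈ D, ‖a P‖ ^ 2 :=
    Finset.sum_congr rfl fun P _ => by
      rw [haz P, mul_pow, Real.sq_sqrt P.I.length_pos.le]
  calc ‖∑ P ∈ D, a P • v P‖ ^ 2 = ‖inner ℂ (∑ P ∈ D, a P • v P) (∑ P ∈ D, a P • v P)‖ := by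
        rw [inner_self_eq_norm_sq_to_K]
        simp
    _ ≤ ∑ P ∈ D, ∑ Q ∈ D, ‖a P‖ * ‖a Q‖ * ‖inner ℂ (v P) (v Q)‖ := by
        rw [sum_inner]
        refine (norm_sum_le _ _).trans (Finset.sum_le_sum fun P _ => ?_)
        rw [inner_sum]
        refine (norm_sum_le _ _).trans (Finset.sum_le_sum fun Q _ => le_of_eq ?_)
        rw [inner_smul_left, inner_smul_right, norm_mul, norm_mul, RCLike.norm_conj, mul_assoc]
    _ ≤ ∑ P ∈ D, ∑ Q ∈ D, A * (R P Q + R Q P) :=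
        Finset.sum_le_sum fun P hP => Finset.sum_le_sum fun Q hQ => hpair P hP Q hQ
    _ = 2 * A * ∑ Q ∈ D, ∑ P ∈ D, R P Q := by
        simp only [mul_add, Finset.sum_add_distrib, ← Finset.mul_sum]
        rw [Finset.sum_comm]
        ring
    _ ≤ 2 * A * ((32 * Real.pi * K + 4 * κ ^ 8 * Real.pi * K +
          64 * (2 + 786432 * Real.pi ^ 3 * K)) * ∑ P ∈ D, z P ^ 2 * P.I.length) :=
        mul_le_mul_of_nonneg_left hmain (mul_nonneg zero_le_two hv.nonneg)
    _ = _ := by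
        rw [hE, levelConstant]
        ring

/-- Bessel's inequality with a loss proportional to the number `L ≥ 2 log₂ M` of level classes. -/
theorem norm_sum_le (hT : IsTreeAssignment F S T) (hM : CountingBound F M)
    (hM0 : 0 ≤ M) (hC₀ : 0 < C₀) (hκ : 1 ≤ κ) {K : ℕ} (hK : κ ^ 2 < 2 ^ K) {v : Tile → H} {A : ℝ}
    (hv : AlmostOrthogonal S v A) {L : ℕ} (hL0 : 0 < L) (hL : M ^ 2 ≤ 2 ^ L) (a : Tile → ℂ) :
    ‖∑ P ∈ S, a P • v P‖ ≤ L * (√(levelConstant κ A K) * √(∑ P ∈ S, ‖a P‖ ^ 2)) := by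
  classical
  -- Zero coefficients have no level: the lower bound 8^n ≤ z fails for z = 0.
  set S' := S.filter fun P => a P ≠ 0 with hS'
  set n : Tile → ℤ := fun P => Int.log 8 (‖a P‖ / √P.I.length) with hn
  have hsum : ∑ P ∈ S, a P • v P = ∑ P ∈ S', a P • v P := by
    rw [hS', Finset.sum_filter]
    refine Finset.sum_congr rfl fun P _ => ?_
    split_ifs with h
    · rfl
    · rw [not_not.mp h, zero_smul]
  have hclass : ∀ r : ℤ, ‖∑ P ∈ S' with n P % L = r, a P • v P‖ ≤
      √(levelConstant κ A K) * √(∑ P ∈ S, ‖a P‖ ^ 2) := by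
    intro r
    set D := S'.filter fun P => n P % L = r with hD
    have hDS : D ⊆ S := (Finset.filter_subset _ _).trans (Finset.filter_subset _ _)
    have hpos : ∀ P ∈ D, 0 < ‖a P‖ / √P.I.length := fun P hP =>
      div_pos (norm_pos_iff.mpr (Finset.mem_filter.mp (Finset.mem_filter.mp hP).1).2)
        (Real.sqrt_pos.mpr P.I.length_pos)
    have h := hT.norm_sq_sum_levels_le hM hM0 hC₀ hκ hK hv D hDS n hL (fun P hP Q hQ hlt => by
      have h1 : n P ≡ n Q [ZMOD L] :=
        (Finset.mem_filter.mp hP).2.trans (Finset.mem_filter.mp hQ).2.symm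
      have h2 := Int.le_of_dvd (sub_pos.mpr hlt) h1.dvd
      linarith) a
      (fun P hP => by exact_mod_cast Int.zpow_log_le_self (b := 8) (by norm_num) (hpos P hP))
      (fun P _ => by
        exact_mod_cast (Int.lt_zpow_succ_log_self (b := 8) (by norm_num) (‖a P‖ / √P.I.length)).le)
    rw [← Real.sqrt_mul (levelConstant_nonneg κ hv.nonneg K)]
    refine Real.le_sqrt_of_sq_le (h.trans ?_)
    refine mul_le_mul_of_nonneg_left (Finset.sum_le_sum_of_subset_of_nonneg hDS
      fun P _ _ => by positivity) (levelConstant_nonneg κ hv.nonneg K)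
  have hL' : (0 : ℤ) < L := by exact_mod_cast hL0
  -- Distinct levels in one residue class mod L differ by at least L; the L classes are added by the
  -- triangle inequality.
  rw [hsum, ← Finset.sum_fiberwise_of_maps_to (t := Finset.Ico (0 : ℤ) L) (g := fun P => n P % L)
    fun P _ => Finset.mem_Ico.mpr ⟨Int.emod_nonneg _ hL'.ne', Int.emod_lt_of_pos _ hL'⟩]
  refine (norm_sum_le_of_le _ fun r _ => hclass r).trans (le_of_eq ?_)
  simp

end IsTreeAssignment

end Forest

/-! ### Passage to L² and to infinite sums -/

theorem exists_treeAssignment {C₀ κ : ℝ} {F : Set (LacunaryTree C₀ κ)} (hF : IsForest F)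
    (S : Finset Tile) (hS : ∀ P ∈ S, P ∈ forestTiles F) (T₀ : LacunaryTree C₀ κ) :
    ∃ T, IsTreeAssignment F S T := by
  have h : ∀ P : Tile, ∃ U : LacunaryTree C₀ κ, P ∈ S → U ∈ F ∧ P ∈ U.tiles := by
    intro P
    by_cases hP : P ∈ S
    · have h1 := hS P hP
      simp only [forestTiles, mem_iUnion] at h1
      obtain ⟨U, hU, hPU⟩ := h1
      exact ⟨U, fun _ => ⟨hU, hPU⟩⟩
    -- `T₀` is only a default value for tiles outside `S`.
    · exact ⟨T₀, fun h => absurd h hP⟩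
  choose T hT using h
  exact ⟨T, hF, fun P hP => (hT P hP).1, fun P hP => (hT P hP).2⟩

theorem inner_toLp {f g : ℝ → ℂ} (hf : MemLp f 2 volume) (hg : MemLp g 2 volume) :
    inner ℂ (hf.toLp f) (hg.toLp g) = ∫ x, inner ℂ (f x) (g x) := by
  rw [L2.inner_def]
  refine integral_congr_ae ?_
  filter_upwards [hf.coeFn_toLp, hg.coeFn_toLp] with x h1 h2
  rw [h1, h2]

theorem almostOrthogonal_toLp {N : ℕ} (hN : 1 ≤ N) {B : ℝ} {𝓟 : Set Tile} {ψ : Tile → ℝ → ℂ}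
    (hψ : ∀ P ∈ 𝓟, IsWavePacket N B P (ψ P)) (S : Finset Tile) (hS : ∀ P ∈ S, P ∈ 𝓟)
    (v : Tile → Lp ℂ 2 (volume : Measure ℝ))
    (hv : ∀ P (hP : P ∈ 𝓟), v P = ((hψ P hP).memLp hN).toLp (ψ P)) :
    AlmostOrthogonal S v (16 * Real.pi * B ^ 2) where
  nonneg := by positivity
  inner_eq_zero P hP Q hQ h1 h2 := by
    rw [hv P (hS P hP), hv Q (hS Q hQ), inner_toLp]
    exact (hψ P (hS P hP)).integral_inner_eq_zero hN (hψ Q (hS Q hQ)) h1 h2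
  norm_inner_le P hP Q hQ h := by
    rw [hv P (hS P hP), hv Q (hS Q hQ), inner_toLp]
    exact (hψ P (hS P hP)).norm_integral_inner_le hN (hψ Q (hS Q hQ))
      (Tile.length_le_of_freq_subset h)

/-- A family whose finite combinations obey a Bessel inequality is unconditionally summable against
square summable coefficients. -/
theorem summable_and_norm_tsum_le {ι H : Type*} [NormedAddCommGroup H] [NormedSpace ℂ H]
    [CompleteSpace H] (w : ι → H) (a : lp (fun _ : ι => ℂ) 2) {C : ℝ} (hC : 0 ≤ C)
    (h : ∀ s : Finset ι, ‖∑ i ∈ s, a i • w i‖ ≤ C * √(∑ i ∈ s, ‖a i‖ ^ 2)) :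
    Summable (fun i => a i • w i) ∧ ‖∑' i, a i • w i‖ ≤ C * ‖a‖ := by
  have hle : ∀ s : Finset ι, √(∑ i ∈ s, ‖a i‖ ^ 2) ≤ ‖a‖ := by
    intro s
    have h1 := lp.sum_rpow_le_norm_rpow (p := 2) (by norm_num) a s
    norm_num at h1
    exact (Real.sqrt_le_left (norm_nonneg a)).mpr h1
  have hsq : Summable fun i => ‖a i‖ ^ 2 := by
    refine summable_of_sum_le (c := ‖a‖ ^ 2) (fun i => by positivity) fun s => ?_
    exact (Real.sqrt_le_left (norm_nonneg a)).mp (hle s)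
  have hs : Summable fun i => a i • w i := by
    rw [summable_iff_vanishing_norm] at hsq ⊢
    intro ε hε
    -- `C + 1` avoids dividing by zero when C = 0.
    obtain ⟨s, hs⟩ := hsq ((ε / (C + 1)) ^ 2) (by positivity)
    refine ⟨s, fun t ht => (h t).trans_lt ?_⟩
    have h2 := hs t ht
    have h3 : √(∑ i ∈ t, ‖a i‖ ^ 2) < ε / (C + 1) := by
      rw [Real.sqrt_lt' (by positivity)]
      exact (le_abs_self _).trans_lt h2
    calc C * √(∑ i ∈ t, ‖a i‖ ^ 2) ≤ (C + 1) * √(∑ i ∈ t, ‖a i‖ ^ 2) := by gcongr; linarith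
      _ < (C + 1) * (ε / (C + 1)) := by gcongr
      _ = ε := by field_simp
  refine ⟨hs, le_of_tendsto hs.hasSum.norm (Filter.Eventually.of_forall fun s => (h s).trans ?_)⟩
  gcongr
  exact hle s

/-- L is 2 log₂(2+M) rounded up; since log₂(2+M) ≥ 1, rounding is absorbed by replacing 2 with 3. -/
theorem exists_nat_log_bound {M : ℝ} (hM : 0 ≤ M) :
    ∃ L : ℕ, 0 < L ∧ M ^ 2 ≤ 2 ^ L ∧ (L : ℝ) ≤ 3 / Real.log 2 * Real.log (2 + M) := by
  have h2 : 0 < Real.log 2 := Real.log_pos one_lt_two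
  have hlog : Real.log 2 ≤ Real.log (2 + M) := Real.log_le_log two_pos (by linarith)
  have hpos : 0 < 2 * Real.log (2 + M) / Real.log 2 := by
    have := h2.trans_le hlog
    positivity
  refine ⟨⌈2 * Real.log (2 + M) / Real.log 2⌉₊, Nat.ceil_pos.mpr hpos, ?_, ?_⟩
  · have h1 := Nat.le_ceil (2 * Real.log (2 + M) / Real.log 2)
    set L := ⌈2 * Real.log (2 + M) / Real.log 2⌉₊
    rw [div_le_iff₀ h2] at h1
    have h3 : (2 + M) ^ 2 ≤ 2 ^ L := by
      rw [← Real.log_le_log_iff (by positivity) (by positivity), Real.log_pow, Real.log_pow]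
      exact_mod_cast h1
    nlinarith
  · have h1 := (Nat.ceil_lt_add_one hpos.le).le
    refine h1.trans ?_
    have h3 : 1 ≤ Real.log (2 + M) / Real.log 2 := (one_le_div h2).mpr hlog
    calc 2 * Real.log (2 + M) / Real.log 2 + 1
        ≤ 2 * Real.log (2 + M) / Real.log 2 + Real.log (2 + M) / Real.log 2 := by gcongr
      _ = _ := by ring

end WavePackets

end

theorem mainTheorem6 (N : ℕ) (hN : 1 ≤ N) (C₀ κ B : ℝ) (hC₀ : 0 < C₀) (hκ : 1 ≤ κ) :
    ∃ C : ℝ, 0 < C ∧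
      ∀ (F : Set (WavePackets.LacunaryTree C₀ κ)), WavePackets.IsForest F →
      ∀ (M : ℝ), 0 ≤ M →
        eLpNorm (WavePackets.countingFunction F) ⊤ volume ≤ ENNReal.ofReal M →
      ∀ (ψ : WavePackets.Tile → ℝ → ℂ)
        (hψ : ∀ P ∈ WavePackets.forestTiles F, WavePackets.IsWavePacket N B P (ψ P))
        (a : lp (fun _ : WavePackets.forestTiles F => ℂ) 2),
        Summable (fun P : WavePackets.forestTiles F =>
          a P • ((hψ P P.2).memLp hN).toLp (ψ P)) ∧
        ‖∑' P : WavePackets.forestTiles F, a P • ((hψ P P.2).memLp hN).toLp (ψ P)‖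
          ≤ C * Real.log (2 + M) * ‖a‖ := by
  classical
  obtain ⟨K, hK⟩ := pow_unbounded_of_one_lt (κ ^ 2) (one_lt_two (α := ℝ))
  set X : ℝ := √(WavePackets.levelConstant κ (16 * Real.pi * B ^ 2) K) with hX
  have hX0 : 0 ≤ X := Real.sqrt_nonneg _
  have hlog2 : 0 < Real.log 2 := Real.log_pos one_lt_two
  -- The added 1 keeps the constant positive even when X = 0, as no sign of `B` is assumed.
  refine ⟨3 / Real.log 2 * X + 1, by positivity, fun F hF M hM hFM ψ hψ a => ?_⟩
  have hlog : 0 ≤ Real.log (2 + M) := Real.log_nonneg (by linarith)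
  refine WavePackets.summable_and_norm_tsum_le
    (fun P : WavePackets.forestTiles F => ((hψ P P.2).memLp hN).toLp (ψ P)) a (by positivity)
    fun s => ?_
  rcases s.eq_empty_or_nonempty with rfl | ⟨P₀, -⟩
  · simp
  obtain ⟨T₀, -⟩ : ∃ T₀ : WavePackets.LacunaryTree C₀ κ, T₀ ∈ F := by
    have h := P₀.2
    simp only [WavePackets.forestTiles, mem_iUnion] at h
    exact ⟨h.choose, h.choose_spec.choose⟩
  obtain ⟨L, hL0, hL, hLlog⟩ := WavePackets.exists_nat_log_bound hM
  set S : Finset WavePackets.Tile := s.map (Function.Embedding.subtype _) with hS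
  have hSF : ∀ P ∈ S, P ∈ WavePackets.forestTiles F := by
    intro P hP
    obtain ⟨Q, -, rfl⟩ := Finset.mem_map.mp hP
    exact Q.2
  obtain ⟨T, hT⟩ := WavePackets.exists_treeAssignment hF S hSF T₀
  set v : WavePackets.Tile → Lp ℂ 2 (volume : Measure ℝ) := fun P =>
    if hP : P ∈ WavePackets.forestTiles F then ((hψ P hP).memLp hN).toLp (ψ P) else 0 with hv
  set b : WavePackets.Tile → ℂ := fun P =>
    if hP : P ∈ WavePackets.forestTiles F then a ⟨P, hP⟩ else 0 with hb
  have hortho := WavePackets.almostOrthogonal_toLp hN hψ S hSF v fun P hP => by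
    simp only [hv, dif_pos hP]
  have h := hT.norm_sum_le (WavePackets.countingBound_of_eLpNorm_le hM hFM) hM hC₀ hκ hK hortho
    hL0 hL b
  have h1 : ∑ P ∈ S, b P • v P =
      ∑ P ∈ s, a P • ((hψ P P.2).memLp hN).toLp (ψ P) := by
    rw [hS, Finset.sum_map]
    refine Finset.sum_congr rfl fun P _ => ?_
    simp only [hb, hv, Function.Embedding.subtype_apply, dif_pos P.2]
  have h2 : ∑ P ∈ S, ‖b P‖ ^ 2 = ∑ P ∈ s, ‖a P‖ ^ 2 := by
    rw [hS, Finset.sum_map]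
    refine Finset.sum_congr rfl fun P _ => ?_
    simp only [hb, Function.Embedding.subtype_apply, dif_pos P.2]
  rw [h1, h2] at h
  refine h.trans ?_
  rw [← mul_assoc]
  refine mul_le_mul_of_nonneg_right ?_ (Real.sqrt_nonneg _)
  calc (L : ℝ) * X ≤ 3 / Real.log 2 * Real.log (2 + M) * X := by gcongr
    _ = 3 / Real.log 2 * X * Real.log (2 + M) := by ring
    _ ≤ _ := by rw [add_mul]; linarith
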